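/- Let $\tfrac12 \le p < 1$ and consider the frog model on $\mathbb{Z}$ with drift parameter $p$: initially there is one active frog at the origin and one sleeping frog at every other site; each active frog performs, independently of the others, a discrete-time simple random walk that jumps to the right with probability $p$ and to the left with probability $1-p$; a sleeping frog becomes active when its site is visited by an active frog, and from then on performs such a walk itself. Let $M_n$ be the maximum of the locations of the active frogs at time $n$. Then there is a constant $v_{\max} = v_{\max}(p) > 0$, the speed of the maximum, such that $\lim_{n\to\infty} M_n/n = v_{\max}$ almost surely, and $$v_{\max} < 1.$$ Moreover, if $p > \tfrac12$, then $$\frac{1}{v_{\max}} \;\ge\; 1 + 2\,(1-p)^{\frac{(2-p)p}{(1-p)(2p-1)}} \;>\; 1.$$ -/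

import Mathlib

open MeasureTheory ProbabilityTheory Filter Topology

/-! The frog model on the integers. The deterministic part of the definitions is written for an
array of steps `ξ : ℤ → ℕ → ℤ`, where `ξ i k` is the `(k+1)`-st step of the frog that is initially
at the site `i`. -/

namespace FrogModel

/-- Displacement of the frog `i` after `n` steps. -/
def walk (ξ : ℤ → ℕ → ℤ) (i : ℤ) (n : ℕ) : ℤ := ∑ k ∈ Finset.range n, ξ i k

/-- Number of steps that the frog `i` needs, once it is awake, to reach the site `j` for the first
time (`⊤` if it never gets there). -/
noncomputable def hittingTime (ξ : ℤ → ℕ → ℤ) (i j : ℤ) : ℕ∞ :=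
  ⨅ (n : ℕ) (_ : i + walk ξ i n = j), (n : ℕ∞)

/-- Activation time of the frog `j` when initially only the frog at the origin is awake: the
infimum, over all finite chains of frogs `0 = x 0, x 1, …, x m = j`, of the total time in which
the frogs of the chain wake up one another successively. -/
noncomputable def activationTime (ξ : ℤ → ℕ → ℤ) (j : ℤ) : ℕ∞ :=
  ⨅ (m : ℕ) (x : ℕ → ℤ) (_ : x 0 = 0) (_ : x m = j),
    ∑ k ∈ Finset.range m, hittingTime ξ (x k) (x (k + 1))

/-- The set of frogs that are awake at time `n`. -/
def active (ξ : ℤ → ℕ → ℤ) (n : ℕ) : Set ℤ := {i | activationTime ξ i ≤ (n : ℕ∞)}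

open Classical in
/-- Location at time `n` of the frog that is initially at the site `i`. -/
noncomputable def position (ξ : ℤ → ℕ → ℤ) (i : ℤ) (n : ℕ) : ℤ :=
  if activationTime ξ i ≤ (n : ℕ∞) then i + walk ξ i (n - (activationTime ξ i).toNat) else i

/-- Maximum of the locations of the frogs that are awake at time `n`. -/
noncomputable def maximum (ξ : ℤ → ℕ → ℤ) (n : ℕ) : ℤ :=
  sSup ((fun i => position ξ i n) '' active ξ n)

theorem abs_walk_le {ξ : ℤ → ℕ → ℤ} (hξ : ∀ i k, ξ i k = 1 ∨ ξ i k = -1) (i : ℤ) (n : ℕ) :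
    |walk ξ i n| ≤ n := by
  refine (Finset.abs_sum_le_sum_abs _ _).trans ?_
  have h : ∀ k ∈ Finset.range n, |ξ i k| ≤ 1 := by
    intro k _
    rcases hξ i k with h | h <;> simp [h]
  simpa using Finset.sum_le_sum h

theorem le_hittingTime {ξ : ℤ → ℕ → ℤ} (hξ : ∀ i k, ξ i k = 1 ∨ ξ i k = -1) (i j : ℤ) :
    ((j - i).natAbs : ℕ∞) ≤ hittingTime ξ i j := by
  refine le_iInf₂ fun n hn => ?_
  have h := abs_le.mp (abs_walk_le hξ i n)
  have h2 : j - i = walk ξ i n := by omega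
  rw [h2]
  exact_mod_cast (by omega : (walk ξ i n).natAbs ≤ n)

theorem le_activationTime {ξ : ℤ → ℕ → ℤ} (hξ : ∀ i k, ξ i k = 1 ∨ ξ i k = -1) (j : ℤ) :
    (j.natAbs : ℕ∞) ≤ activationTime ξ j := by
  refine le_iInf fun m => le_iInf fun x => le_iInf fun h0 => le_iInf fun hm => ?_
  subst hm
  induction m with
  | zero => simp [h0]
  | succ m ih =>
    rw [Finset.sum_range_succ]
    refine le_trans ?_ (add_le_add ih (le_hittingTime hξ _ _))
    exact_mod_cast (by omega : (x (m + 1)).natAbs ≤ (x m).natAbs + (x (m + 1) - x m).natAbs)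

/-- For steps `±1` the supremum in the definition of `maximum` is attained. -/
theorem isGreatest_maximum {ξ : ℤ → ℕ → ℤ} (hξ : ∀ i k, ξ i k = 1 ∨ ξ i k = -1) (n : ℕ) :
    IsGreatest ((fun i => position ξ i n) '' active ξ n) (maximum ξ n) := by
  have hfin : (active ξ n).Finite := by
    refine (Set.finite_Icc (-(n : ℤ)) n).subset fun i hi => ?_
    have h : i.natAbs ≤ n := by exact_mod_cast (le_activationTime hξ i).trans hi
    constructor <;> omega
  have h0 : (0 : ℤ) ∈ active ξ n := by
    have h : activationTime ξ 0 ≤ 0 := by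
      refine iInf_le_of_le 0 (iInf_le_of_le (fun _ => 0) ?_)
      simp
    exact h.trans (by simp)
  have hb : ((fun i => position ξ i n) '' active ξ n).Finite := hfin.image _
  exact ⟨Int.csSup_mem ⟨_, Set.mem_image_of_mem _ h0⟩ hb.bddAbove,
    fun y hy => le_csSup hb.bddAbove hy⟩

/-- The steps `X i k` are independent and identically distributed random variables which are `1`
with probability `p` and `-1` with probability `1 - p`. -/
structure IsStepArray {Ω : Type*} [MeasurableSpace Ω] (p : ℝ) (P : Measure Ω)
    (X : ℤ → ℕ → Ω → ℤ) : Prop where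
  measurable : ∀ i k, Measurable (X i k)
  indep : iIndepFun (fun q : ℤ × ℕ => X q.1 q.2) P
  prob_right : ∀ i k, P {ω | X i k ω = 1} = ENNReal.ofReal p
  prob_left : ∀ i k, P {ω | X i k ω = -1} = ENNReal.ofReal (1 - p)

end FrogModel

/-!
The speed of the maximum is the inverse of a time constant `γ`: the passage times `T n` from `0`
to `n` are subadditive and stationary under shifts, so that `T n / n` converges almost surely to
`γ = inf E[T n] / n`, and the maximum at a time between `T k` and `T (k + 1)` differs from `k` by
at most the age of the front.

*Convergence.* Everything is done on the space of coin tosses `ℤ → ℕ → Bool` with its product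
measure `modelLaw p`; an arbitrary step array has the same law (`map_eq_modelLaw`). The passage
time to a neighbour is integrable also without drift, because three left steps in a row by the
frog `0` either come after its visit to `1` or wake up the frogs `-1, -2, -3`; each of these
misses the site `1` for `t` steps with probability `O(t ^ (-1/2))` only, independently of the
others (`lintegral_passageTime_one_ne_top`). For the upper bound, the passage times over blocks
are replaced by those that use only the frogs of a finite window, for which the strong law of
large numbers holds (`ae_limsup_le_window`). For the lower bound, the lower limit of `T n / n` is
shift invariant, and the covering argument of Katznelson and Weiss shows that its mean is at least
`γ` (`timeConstant_le_lintegral`).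

*The bound on `γ`.* Let `q = 1 - p`, fix `m`, and call a frog `k - l` fast, seen from `k`, if at
most `l / m` of its first `l + 1` steps go to the left. If the front has come to `k` with a delay
of at most `2 / m` per site, counted from every earlier site, and if there is no fast frog, then
the front does not go on to `k + 1` at once (`passageTime_succ_ne`), which costs two units of
time. By a maximal inequality (`card_not_le_of_sum`), the number of sites at which the delay
condition fails is at most `m / 2` times the total delay. Together, `(m + 1) (T n - n)` is at
least twice the number of sites `k < n` without fast frogs (`card_noFastFrog_le`). Since the frogs
are independent, a site has no fast frogs with probability at least `q ^ (1 / q) / 2` if `m` is of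
the order `q ^ (-2)` (`measure_noFastFrog_ge`), whence `γ ≥ 1 + q ^ (1 / q) / (m + 1)`
(`le_timeConstant`). The exponent `(2 - p) p / ((1 - p) (2 p - 1))` exceeds `1 / q` by `2 + 3 q /
(1 - 2 q)`, and this compensates the factor `2 (m + 1)` (`two_mul_succ_mul_rpow_le`).
-/

namespace FrogModel

/-! ### Chains of frogs and passage times -/

/-- `Reach S ξ i j n`: a chain of frogs that starts with the frog `i`, uses only frogs of `S`, and in
which every frog walks until it wakes up the next one, can arrive at the site `j` at the time `n`
after the frog `i` woke up. The arrivals need not be first visits. -/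
inductive Reach (S : Set ℤ) (ξ : ℤ → ℕ → ℤ) (i : ℤ) : ℤ → ℕ → Prop
  | refl : Reach S ξ i i 0
  | step {x : ℤ} {n : ℕ} (t : ℕ) (h : Reach S ξ i x n) (hx : x ∈ S) :
      Reach S ξ i (x + walk ξ x t) (n + t)

/-- Passage time from `i` to `j` with the frogs of `S` only; it has the junk value `0` if `j` cannot
be reached. -/
noncomputable def passageTime (S : Set ℤ) (ξ : ℤ → ℕ → ℤ) (i j : ℤ) : ℕ :=
  sInf {n | Reach S ξ i j n}

section Deterministic

variable {S S' : Set ℤ} {ξ ξ' : ℤ → ℕ → ℤ} {i j k : ℤ} {n m : ℕ}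

theorem Reach.single (hi : i ∈ S) {t : ℕ} (h : i + walk ξ i t = j) : Reach S ξ i j t := by
  have := Reach.step (ξ := ξ) t (Reach.refl (S := S) (i := i)) hi
  rwa [h, zero_add] at this

theorem Reach.trans (h : Reach S ξ i j n) (h' : Reach S ξ j k m) : Reach S ξ i k (n + m) := by
  induction h' with
  | refl => exact h
  | step t _ hx ih => rw [← add_assoc]; exact ih.step t hx

theorem Reach.mono (hS : S ⊆ S') (h : Reach S ξ i j n) : Reach S' ξ i j n := by
  induction h with
  | refl => exact .refl
  | step t _ hx ih => exact ih.step t (hS hx)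

theorem Reach.congr (hS : ∀ x ∈ S, ξ x = ξ' x) (h : Reach S ξ i j n) : Reach S ξ' i j n := by
  induction h with
  | refl => exact .refl
  | @step x n t _ hx ih =>
    have : walk ξ x t = walk ξ' x t := by simp [walk, hS x hx]
    rw [this]; exact ih.step t hx

theorem Reach.translate {c : ℤ} (h : Reach S (fun x => ξ (x + c)) i j n) :
    Reach ((· - c) ⁻¹' S) ξ (i + c) (j + c) n := by
  induction h with
  | refl => exact .refl
  | @step x n t _ hx ih =>
    have := ih.step t (by simpa using hx)
    simpa [walk, add_right_comm] using this

theorem reach_translate_iff {c : ℤ} :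
    Reach S (fun x => ξ (x + c)) i j n ↔ Reach ((· - c) ⁻¹' S) ξ (i + c) (j + c) n := by
  refine ⟨Reach.translate, fun h => ?_⟩
  have h' : Reach ((· - c) ⁻¹' S) (fun x => (fun y => ξ (y + c)) (x + -c)) (i + c) (j + c) n := by
    simpa using h
  simpa [Set.preimage_preimage] using Reach.translate (ξ := fun y => ξ (y + c)) h'

theorem passageTime_translate {c : ℤ} :
    passageTime S (fun x => ξ (x + c)) i j
      = passageTime ((· - c) ⁻¹' S) ξ (i + c) (j + c) := by
  simp only [passageTime, reach_translate_iff]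

theorem passageTime_congr (hS : ∀ x ∈ S, ξ x = ξ' x) :
    passageTime S ξ i j = passageTime S ξ' i j := by
  have : {n | Reach S ξ i j n} = {n | Reach S ξ' i j n} :=
    Set.ext fun n => ⟨Reach.congr hS, Reach.congr fun x hx => (hS x hx).symm⟩
  rw [passageTime, passageTime, this]

theorem Reach.exists_chain (h : Reach S ξ i j n) :
    ∃ l : List ℤ, (∀ x ∈ l, x ∈ S) ∧ Reach {x | x ∈ l} ξ i j n := by
  induction h with
  | refl => exact ⟨[], by simp, .refl⟩
  | @step x n t _ hx ih =>
    obtain ⟨l, hl, hr⟩ := ih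
    exact ⟨x :: l, by simpa using ⟨hx, hl⟩, (hr.mono fun y hy => by simp_all).step t (by simp)⟩

theorem passageTime_le (h : Reach S ξ i j n) : passageTime S ξ i j ≤ n := Nat.sInf_le h

theorem reach_passageTime (h : ∃ n, Reach S ξ i j n) : Reach S ξ i j (passageTime S ξ i j) :=
  Nat.sInf_mem h

theorem passageTime_self : passageTime S ξ i i = 0 :=
  Nat.le_zero.1 (passageTime_le .refl)

theorem passageTime_mono (hS : S ⊆ S') (h : ∃ n, Reach S ξ i j n) :
    passageTime S' ξ i j ≤ passageTime S ξ i j :=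
  passageTime_le ((reach_passageTime h).mono hS)

theorem passageTime_triangle (h : ∃ n, Reach S ξ i j n) (h' : ∃ n, Reach S ξ j k n) :
    passageTime S ξ i k ≤ passageTime S ξ i j + passageTime S ξ j k :=
  passageTime_le ((reach_passageTime h).trans (reach_passageTime h'))

theorem walk_succ (ξ : ℤ → ℕ → ℤ) (x : ℤ) (t : ℕ) : walk ξ x (t + 1) = walk ξ x t + ξ x t :=
  Finset.sum_range_succ _ _

/-- A walk with steps `±1` visits every site between its starting point and its present position. -/
theorem exists_walk_eq (hξ : ∀ i k, ξ i k = 1 ∨ ξ i k = -1) {x : ℤ} (hx : x ≤ k) {t : ℕ}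
    (ht : k ≤ x + walk ξ x t) : ∃ s ≤ t, x + walk ξ x s = k := by
  induction t with
  | zero => exact ⟨0, le_rfl, by simp [walk] at ht ⊢; omega⟩
  | succ t ih =>
    by_cases h : k ≤ x + walk ξ x t
    · obtain ⟨s, hs, h⟩ := ih h
      exact ⟨s, by omega, h⟩
    · refine ⟨t + 1, le_rfl, ?_⟩
      rw [walk_succ] at ht ⊢
      rcases hξ x t with h | h <;> omega

/-- A chain of frogs that gets from the left of the edge between `k` and `k + 1` to its right
contains a frog that crosses this edge. -/
theorem Reach.exists_crossing (hξ : ∀ i k, ξ i k = 1 ∨ ξ i k = -1) (h : Reach S ξ i j n)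
    (hik : i ≤ k) (hkj : k < j) :
    ∃ x ∈ S, x ≤ k ∧ ∃ s t, Reach S ξ i x s ∧ x + walk ξ x t = k ∧ ξ x t = 1 ∧ s + t + 1 ≤ n := by
  induction h with
  | refl => omega
  | @step x n t h hx ih =>
    by_cases hxk : k < x
    · obtain ⟨y, hy, hyk, s, u, h1, h2, h3, h4⟩ := ih hxk
      exact ⟨y, hy, hyk, s, u, h1, h2, h3, by omega⟩
    · obtain ⟨s, hs, hs'⟩ := exists_walk_eq hξ (k := k + 1) (by omega) hkj
      have hex : ∃ s, x + walk ξ x s = k + 1 := ⟨s, hs'⟩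
      -- at the first visit to `k + 1`, the last step came from `k`
      classical
      have hf := Nat.find_spec hex
      have hfs : Nat.find hex ≤ s := Nat.find_min' hex hs'
      rcases hu : Nat.find hex with _ | u
      · rw [hu] at hf; simp [walk] at hf; omega
      · rw [hu] at hf hfs
        rw [walk_succ] at hf
        have hstep : ξ x u = 1 := by
          rcases hξ x u with h1 | h1
          · exact h1
          · obtain ⟨v, hv, hv'⟩ := exists_walk_eq hξ (ξ := ξ) (x := x) (k := k + 1) (t := u)
              (by omega) (by omega)
            have := Nat.find_min' hex hv'
            omega
        exact ⟨x, hx, by omega, n, u, h, by omega, hstep, by omega⟩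

theorem Reach.exists_between (hξ : ∀ i k, ξ i k = 1 ∨ ξ i k = -1) (h : Reach S ξ i j n)
    (hik : i ≤ k) (hkj : k ≤ j) : ∃ n', n' + (j - k).toNat ≤ n ∧ Reach S ξ i k n' := by
  obtain ⟨d, rfl⟩ : ∃ d : ℕ, j = k + d := ⟨(j - k).toNat, by omega⟩
  clear hkj
  induction d generalizing n with
  | zero => exact ⟨n, by simp, by simpa using h⟩
  | succ d ih =>
    obtain ⟨x, hx, -, s, t, h1, h2, -, h4⟩ :=
      h.exists_crossing hξ (k := k + d) (by omega) (by push_cast; omega)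
    obtain ⟨n', hn', hr⟩ := ih (n := s + t) (h2 ▸ h1.step t hx)
    exact ⟨n', by push_cast at *; omega, hr⟩

theorem walk_parity (hξ : ∀ i k, ξ i k = 1 ∨ ξ i k = -1) (x : ℤ) (t : ℕ) :
    ∃ a : ℕ, (t : ℤ) = walk ξ x t + 2 * a := by
  induction t with
  | zero => exact ⟨0, by simp [walk]⟩
  | succ t ih =>
    obtain ⟨a, ha⟩ := ih
    rw [walk_succ]
    rcases hξ x t with h | h
    · exact ⟨a, by push_cast; omega⟩
    · exact ⟨a + 1, by push_cast; omega⟩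

theorem Reach.parity (hξ : ∀ i k, ξ i k = 1 ∨ ξ i k = -1) (h : Reach S ξ i j n) :
    ∃ a : ℕ, (n : ℤ) = j - i + 2 * a := by
  induction h with
  | refl => exact ⟨0, by simp⟩
  | @step x n t _ _ ih =>
    obtain ⟨a, ha⟩ := ih
    obtain ⟨b, hb⟩ := walk_parity hξ x t
    exact ⟨a + b, by push_cast; omega⟩

theorem passageTime_le_of_le (hξ : ∀ i k, ξ i k = 1 ∨ ξ i k = -1) (h : ∃ n, Reach S ξ i j n)
    (hik : i ≤ k) (hkj : k ≤ j) :
    passageTime S ξ i k + (j - k).toNat ≤ passageTime S ξ i j := by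
  obtain ⟨n', hn', hr⟩ := (reach_passageTime h).exists_between hξ hik hkj
  have := passageTime_le hr
  omega

/-! ### Activation times as passage times -/

theorem exists_of_hittingTime_ne_top (h : hittingTime ξ i j ≠ ⊤) :
    ∃ t : ℕ, i + walk ξ i t = j ∧ hittingTime ξ i j = t := by
  have hd : hittingTime ξ i j = ⨅ t : {t : ℕ // i + walk ξ i t = j}, ((t : ℕ) : ℕ∞) := by
    rw [hittingTime, iInf_subtype]
  have : Nonempty {t : ℕ // i + walk ξ i t = j} := by
    rw [← not_isEmpty_iff]
    intro he
    exact h (by rw [hd, iInf_of_empty])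
  obtain ⟨t, ht⟩ := ENat.exists_eq_iInf (fun t : {t : ℕ // i + walk ξ i t = j} => ((t : ℕ) : ℕ∞))
  exact ⟨t, t.2, by rw [hd, ← ht]⟩

theorem hittingTime_le {t : ℕ} (h : i + walk ξ i t = j) : hittingTime ξ i j ≤ t :=
  iInf₂_le t h

theorem Reach.activationTime_le (h : Reach S ξ 0 j n) : activationTime ξ j ≤ n := by
  suffices ∃ (m : ℕ) (x : ℕ → ℤ), x 0 = 0 ∧ x m = j ∧
      ∑ k ∈ Finset.range m, hittingTime ξ (x k) (x (k + 1)) ≤ n by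
    obtain ⟨m, x, h0, hm, hs⟩ := this
    exact (iInf₂_le_of_le m x (iInf₂_le_of_le h0 hm le_rfl)).trans hs
  induction h with
  | refl => exact ⟨0, fun _ => 0, rfl, rfl, by simp⟩
  | @step y n t _ _ ih =>
    obtain ⟨m, x, h0, hm, hs⟩ := ih
    refine ⟨m + 1, fun k => if k ≤ m then x k else y + walk ξ y t, by simp [h0], by simp, ?_⟩
    rw [Finset.sum_range_succ, Nat.cast_add]
    refine add_le_add ((Finset.sum_congr rfl fun k hk => ?_).trans_le hs) ?_
    · have : k < m := Finset.mem_range.1 hk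
      simp [this.le, Nat.succ_le_of_lt this]
    · simp only [le_refl, if_true, hm]
      simpa using hittingTime_le (ξ := ξ) (i := y) rfl

theorem activationTime_le_iff :
    activationTime ξ j ≤ n ↔ ∃ n' ≤ n, Reach Set.univ ξ 0 j n' := by
  refine ⟨fun h => ?_, fun ⟨n', hn, hr⟩ => hr.activationTime_le.trans (by exact_mod_cast hn)⟩
  have key : ∀ (m : ℕ) (x : ℕ → ℤ) (N : ℕ), x 0 = 0 →
      ∑ k ∈ Finset.range m, hittingTime ξ (x k) (x (k + 1)) ≤ N →
      ∃ n' ≤ N, Reach Set.univ ξ 0 (x m) n' := by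
    intro m
    induction m with
    | zero => intro x N h0 _; exact ⟨0, Nat.zero_le _, h0 ▸ .refl⟩
    | succ m ih =>
      intro x N h0 hs
      rw [Finset.sum_range_succ] at hs
      have hne : hittingTime ξ (x m) (x (m + 1)) ≠ ⊤ := fun he => by
        rw [he, add_top] at hs; exact absurd hs (by simp)
      obtain ⟨t, ht, hte⟩ := exists_of_hittingTime_ne_top hne
      have hsum_ne : ∑ k ∈ Finset.range m, hittingTime ξ (x k) (x (k + 1)) ≠ ⊤ := fun he => by
        rw [he, top_add] at hs; exact absurd hs (by simp)
      obtain ⟨s, hs'⟩ := ENat.ne_top_iff_exists.1 hsum_ne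
      rw [hte, ← hs'] at hs
      obtain ⟨n', hn', hr⟩ := ih x s h0 hs'.symm.le
      refine ⟨n' + t, ?_, ht ▸ hr.step t trivial⟩
      have : s + t ≤ N := by exact_mod_cast hs
      omega
  by_contra hcon
  have : ((n + 1 : ℕ) : ℕ∞) ≤ activationTime ξ j := by
    refine le_iInf fun m => le_iInf fun x => le_iInf fun h0 => le_iInf fun hm => ?_
    by_contra hlt
    rw [not_le] at hlt
    obtain ⟨n', hn', hr⟩ := key m x n h0 (by
      have : ((n + 1 : ℕ) : ℕ∞) = n + 1 := by push_cast; rfl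
      rw [this] at hlt
      exact Order.le_of_lt_add_one hlt)
    exact hcon ⟨n', hn', hm ▸ hr⟩
  have h2 := this.trans h
  have : n + 1 ≤ n := by exact_mod_cast h2
  omega

theorem activationTime_eq (h : ∃ n, Reach Set.univ ξ 0 j n) :
    activationTime ξ j = passageTime Set.univ ξ 0 j := by
  refine le_antisymm (reach_passageTime h).activationTime_le ?_
  refine le_of_not_gt fun hlt => ?_
  obtain ⟨s, hs⟩ := ENat.ne_top_iff_exists.1 hlt.ne_top
  obtain ⟨n', hn', hr⟩ := activationTime_le_iff.1 hs.symm.le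
  rw [← hs] at hlt
  have h1 : s < passageTime Set.univ ξ 0 j := by exact_mod_cast hlt
  have := passageTime_le hr
  omega

end Deterministic

/-! ### Delays of the front -/

/-- A sequence `f` of delays with mean less than `1 / m` satisfies `m * ∑ i ∈ [j, k), f i ≤ k - j`
for all `j ≤ k` at most times `k`: a discrete maximal inequality. -/
theorem card_not_le_of_sum (m : ℕ) (f : ℕ → ℕ) (n : ℕ) :
    ((Finset.range n).filter
      (fun k => ¬ ∀ j ≤ k, m * ∑ i ∈ Finset.Ico j k, f i ≤ k - j)).card
      ≤ m * ∑ i ∈ Finset.range n, f i := by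
  classical
  -- the workload of a queue with input `m * f` that serves one unit per unit of time
  let W : ℕ → ℕ := fun n => Nat.rec 0 (fun n w => w + m * f n - 1) n
  have hW : ∀ n, W (n + 1) = W n + m * f n - 1 := fun n => rfl
  have hW0 : W 0 = 0 := rfl
  have key : ∀ k, ∀ j ≤ k, m * ∑ i ∈ Finset.Ico j k, f i ≤ k - j + W k := by
    intro k j hjk
    induction k, hjk using Nat.le_induction with
    | base => simp
    | succ k hjk ih =>
      rw [Finset.sum_Ico_succ_top hjk, mul_add, hW]
      omega
  have count : ∀ n, W n + ((Finset.range n).filter (fun k => W (k + 1) ≠ 0)).card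
      ≤ m * ∑ i ∈ Finset.range n, f i := by
    intro n
    induction n with
    | zero => simp [hW0]
    | succ n ih =>
      rw [Finset.range_add_one, Finset.filter_insert, Finset.sum_insert (by simp), mul_add]
      split_ifs with h
      · rw [Finset.card_insert_of_notMem (by simp)]
        rw [hW] at h ⊢
        omega
      · rw [not_not] at h
        rw [h]
        omega
  refine le_trans ?_ ((Nat.le_add_left _ _).trans (count n))
  have hsub : (Finset.range n).filter
      (fun k => ¬ ∀ j ≤ k, m * ∑ i ∈ Finset.Ico j k, f i ≤ k - j)
      ⊆ ((Finset.range n).filter (fun k => W (k + 1) ≠ 0)).map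
        ⟨Nat.succ, Nat.succ_injective⟩ := by
    intro k hk
    rw [Finset.mem_filter] at hk
    have hWk : W k ≠ 0 := fun h => hk.2 fun j hj => by simpa [h] using key k j hj
    rw [Finset.mem_map]
    have hkn := Finset.mem_range.1 hk.1
    cases k with
    | zero => exact absurd hW0 hWk
    | succ k => exact ⟨k, by simp [hWk]; omega, rfl⟩
  exact (Finset.card_le_card hsub).trans (Finset.card_map _).le

/-- Number of steps to the left among the first `n` steps of the frog `i`. -/
def leftSteps (ξ : ℤ → ℕ → ℤ) (i : ℤ) (n : ℕ) : ℕ :=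
  ((Finset.range n).filter (fun t => ξ i t = -1)).card

/-- There is no fast frog at or to the left of `k`. The frog `k - l` is fast, seen from `k`, if at most
`l / m` of its first `l + 1` steps go to the left. -/
def NoFastFrog (m : ℕ) (ξ : ℤ → ℕ → ℤ) (k : ℤ) : Prop :=
  ∀ l : ℕ, l < m * leftSteps ξ (k - l) (l + 1)

theorem leftSteps_succ (ξ : ℤ → ℕ → ℤ) (i : ℤ) (n : ℕ) :
    leftSteps ξ i (n + 1) = leftSteps ξ i n + if ξ i n = -1 then 1 else 0 := by
  rw [leftSteps, Finset.range_add_one, Finset.filter_insert]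
  split_ifs with h
  · rw [Finset.card_insert_of_notMem (by simp)]; rfl
  · rfl

theorem leftSteps_mono (ξ : ℤ → ℕ → ℤ) (i : ℤ) : Monotone (leftSteps ξ i) :=
  monotone_nat_of_le_succ fun n => by rw [leftSteps_succ]; omega

section Deterministic

variable {ξ : ℤ → ℕ → ℤ} (hξ : ∀ i k, ξ i k = 1 ∨ ξ i k = -1)
include hξ

theorem walk_eq_sub_leftSteps (i : ℤ) (n : ℕ) : walk ξ i n = n - 2 * leftSteps ξ i n := by
  induction n with
  | zero => simp [walk, leftSteps]
  | succ n ih =>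
    rw [walk_succ, ih, leftSteps_succ]
    rcases hξ i n with h | h <;> simp [h] <;> ring

/-- If the front arrives at `k` with little delay, measured from all earlier sites, and there is
no fast frog, then the front does not proceed to `k + 1` at once: the frog that crosses the edge would
have to be one that is fast. -/
theorem passageTime_succ_ne {m : ℕ} {k : ℕ}
    (hr : ∀ j : ℕ, ∃ n, Reach Set.univ ξ 0 j n)
    (hgood : ∀ j ≤ k, m * (passageTime Set.univ ξ 0 k)
      ≤ m * (passageTime Set.univ ξ 0 j + (k - j)) + 2 * (k - j))
    (hA : NoFastFrog m ξ k) :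
    passageTime Set.univ ξ 0 (k + 1 : ℕ) ≠ passageTime Set.univ ξ 0 k + 1 := by
  intro heq
  obtain ⟨x, -, hxk, s, t, h1, h2, h3, h4⟩ := (reach_passageTime (hr (k + 1))).exists_crossing hξ
    (k := k) (by omega) (by push_cast; omega)
  have h5 : passageTime Set.univ ξ 0 k ≤ s + t := passageTime_le (h2 ▸ h1.step t trivial)
  have h6 : passageTime Set.univ ξ 0 k = s + t := by omega
  obtain ⟨l, rfl⟩ : ∃ l : ℕ, x = k - l := ⟨(k - x).toNat, by omega⟩
  -- the crossing frog needs at most `(1 + 2 / m) * l` steps from `k - l` to `k`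
  have h7 : m * t ≤ m * l + 2 * l := by
    rcases le_or_gt l k with hl | hl
    · have h8 : passageTime Set.univ ξ 0 ((k - l : ℕ) : ℤ) ≤ s :=
        passageTime_le (by rw [Nat.cast_sub hl]; exact h1)
      have h9 := hgood (k - l) (by omega)
      have h10 : k - (k - l) = l := by omega
      rw [h10, h6] at h9
      have h11 := Nat.mul_le_mul_left m h8
      simp only [mul_add] at h9
      omega
    · have h9 := hgood 0 (by omega)
      rw [Nat.cast_zero, passageTime_self, h6] at h9
      have h10 := Nat.mul_le_mul_left m hl.le
      simp only [mul_add, mul_zero] at h9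
      simp only [zero_add, Nat.sub_zero] at h9
      omega
  have h8 := walk_eq_sub_leftSteps hξ (k - l) t
  have h9 : (t : ℤ) = l + 2 * leftSteps ξ (k - l) t := by omega
  have h10 : leftSteps ξ (k - l) (t + 1) = leftSteps ξ (k - l) t := by
    rw [leftSteps_succ]; simp [h3]
  have h11 : leftSteps ξ (k - l) (l + 1) ≤ leftSteps ξ (k - l) t :=
    h10 ▸ leftSteps_mono ξ _ (by omega)
  have h12 := hA l
  have h13 := Nat.mul_le_mul_left m h11
  have h14 : t = l + 2 * leftSteps ξ (k - l) t := by exact_mod_cast h9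
  have h15 : m * t = m * l + 2 * (m * leftSteps ξ (k - l) t) := by
    conv_lhs => rw [h14]
    ring
  omega

open Classical in
/-- The number of sites without fast frogs bounds the total delay of the front from below. -/
theorem card_noFastFrog_le (m : ℕ) (hr : ∀ j : ℕ, ∃ n, Reach Set.univ ξ 0 j n) (n : ℕ) :
    (m + 1) * n + 2 * ((Finset.range n).filter (fun k => NoFastFrog m ξ (k : ℕ))).card
      ≤ (m + 1) * passageTime Set.univ ξ 0 n := by
  let T : ℕ → ℕ := fun j => passageTime Set.univ ξ 0 j
  have hT0 : T 0 = 0 := by simpa [T] using passageTime_self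
  have hpar : ∀ j, ∃ a, T j = j + 2 * a := by
    intro j
    obtain ⟨a, ha⟩ := (reach_passageTime (hr j)).parity hξ
    exact ⟨a, by simp only [T]; omega⟩
  have hsucc : ∀ j, T j + 1 ≤ T (j + 1) := by
    intro j
    have := passageTime_le_of_le hξ (hr (j + 1)) (k := j) (by omega) (by push_cast; omega)
    simp only [T]
    omega
  let f : ℕ → ℕ := fun j => (T (j + 1) - T j - 1) / 2
  have hf : ∀ j, T (j + 1) = T j + 1 + 2 * f j := by
    intro j
    obtain ⟨a, ha⟩ := hpar j
    obtain ⟨b, hb⟩ := hpar (j + 1)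
    have := hsucc j
    simp only [f]
    omega
  have hsum : ∀ k, ∀ j ≤ k, T k = T j + (k - j) + 2 * ∑ i ∈ Finset.Ico j k, f i := by
    intro k j hjk
    induction k, hjk using Nat.le_induction with
    | base => simp
    | succ k hjk ih =>
      rw [Finset.sum_Ico_succ_top hjk, hf, ih]
      omega
  have hsub : (Finset.range n).filter (fun k => NoFastFrog m ξ (k : ℕ)) ⊆
      (Finset.range n).filter
        (fun k => ¬ ∀ j ≤ k, m * ∑ i ∈ Finset.Ico j k, f i ≤ k - j)
      ∪ (Finset.range n).filter (fun k => f k ≠ 0) := by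
    intro k hk
    rw [Finset.mem_filter] at hk
    rw [Finset.mem_union, Finset.mem_filter, Finset.mem_filter]
    by_contra hcon
    push Not at hcon
    have hgood := hcon.1 hk.1
    refine passageTime_succ_ne hξ hr (fun j hj => ?_) hk.2 ?_
    · have h1 := hgood j hj
      have h2 := hsum k j hj
      change m * T k ≤ m * (T j + (k - j)) + 2 * (k - j)
      rw [h2, mul_add]
      have : m * (2 * ∑ i ∈ Finset.Ico j k, f i) = 2 * (m * ∑ i ∈ Finset.Ico j k, f i) := by ring
      omega
    · have h1 := hf k
      rw [hcon.2 hk.1] at h1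
      exact h1
  have h1 := (Finset.card_le_card hsub).trans (Finset.card_union_le _ _)
  have h2 := card_not_le_of_sum m f n
  have h3 : ((Finset.range n).filter (fun k => f k ≠ 0)).card ≤ ∑ i ∈ Finset.range n, f i := by
    rw [Finset.card_filter]
    exact Finset.sum_le_sum fun i _ => by split_ifs <;> omega
  have h4 := hsum n 0 (Nat.zero_le _)
  rw [hT0, Nat.Ico_zero_eq_range] at h4
  change _ ≤ (m + 1) * T n
  rw [h4]
  have h5 : (m + 1) * (0 + (n - 0) + 2 * ∑ i ∈ Finset.range n, f i)
      = (m + 1) * n + 2 * (m * ∑ i ∈ Finset.range n, f i + ∑ i ∈ Finset.range n, f i) := by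
    rw [Nat.sub_zero]; ring
  rw [h5]
  convert Nat.add_le_add_left (Nat.mul_le_mul_left 2 (h1.trans (Nat.add_le_add h2 h3))) _ using 4

end Deterministic

/-! ### From passage times to the maximum -/

theorem le_passageTime {ξ : ℤ → ℕ → ℤ} (hξ : ∀ i k, ξ i k = 1 ∨ ξ i k = -1) {k : ℕ}
    (hr : ∃ n, Reach Set.univ ξ 0 k n) : k ≤ passageTime Set.univ ξ 0 k := by
  have := passageTime_le_of_le hξ hr (k := 0) le_rfl (by omega)
  omega

theorem maximum_le {ξ : ℤ → ℕ → ℤ} (hξ : ∀ i k, ξ i k = 1 ∨ ξ i k = -1) {k n : ℕ}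
    (hk : n < passageTime Set.univ ξ 0 (k + 1 : ℕ)) : maximum ξ n ≤ k := by
  obtain ⟨i, hi, hpos⟩ := (isGreatest_maximum hξ n).1
  rw [← hpos]
  simp only [active, Set.mem_ofPred_eq] at hi
  by_contra hlt
  simp only [position, if_pos hi] at hlt
  obtain ⟨n', hn', hr⟩ := activationTime_le_iff.1 hi
  have hact := activationTime_eq ⟨n', hr⟩
  have hle : passageTime Set.univ ξ 0 i ≤ n := (passageTime_le hr).trans hn'
  rw [hact, ENat.toNat_natCast] at hlt
  have h1 := (reach_passageTime ⟨n', hr⟩).step (n - passageTime Set.univ ξ 0 i) trivial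
  obtain ⟨a, ha, hra⟩ := h1.exists_between hξ (k := (k + 1 : ℕ)) (by omega) (by push_cast; omega)
  have := passageTime_le hra
  omega

theorem le_maximum {ξ : ℤ → ℕ → ℤ} (hξ : ∀ i k, ξ i k = 1 ∨ ξ i k = -1) {k n : ℕ}
    (hr : ∃ n, Reach Set.univ ξ 0 k n) (hk : passageTime Set.univ ξ 0 k ≤ n) :
    (k : ℤ) - (n - passageTime Set.univ ξ 0 k) ≤ maximum ξ n := by
  have hact := activationTime_eq hr
  have hle : activationTime ξ k ≤ n := by rw [hact]; exact_mod_cast hk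
  refine le_trans ?_ ((isGreatest_maximum hξ n).2 ⟨k, hle, rfl⟩)
  simp only [position, if_pos hle]
  rw [hact, ENat.toNat_natCast]
  have := abs_le.1 (abs_walk_le hξ k (n - passageTime Set.univ ξ 0 k))
  omega

/-- If the front needs the time `γ` per site, then the maximum has the speed `1 / γ`: the frog that
was woken up at the front cannot have fallen back by more than the time that has passed since. -/
theorem tendsto_maximum {ξ : ℤ → ℕ → ℤ} (hξ : ∀ i k, ξ i k = 1 ∨ ξ i k = -1)
    (hr : ∀ j : ℕ, ∃ n, Reach Set.univ ξ 0 j n) {γ : ℝ} (hγ : 0 < γ)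
    (h : Tendsto (fun n : ℕ => (passageTime Set.univ ξ 0 n : ℝ) / n) atTop (𝓝 γ)) :
    Tendsto (fun n : ℕ => (maximum ξ n : ℝ) / n) atTop (𝓝 (1 / γ)) := by
  let T : ℕ → ℕ := fun j => passageTime Set.univ ξ 0 j
  change Tendsto (fun n : ℕ => (T n : ℝ) / n) atTop (𝓝 γ) at h
  have hTk : ∀ k, k ≤ T k := fun k => le_passageTime hξ (hr k)
  let K : ℕ → ℕ := fun n => Nat.findGreatest (fun k => T k ≤ n) n
  have hK1 : ∀ n, T (K n) ≤ n := by
    intro n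
    refine Nat.findGreatest_spec (P := fun k => T k ≤ n) (Nat.zero_le n) ?_
    simpa [T] using (passageTime_self (S := Set.univ) (ξ := ξ) (i := 0)).le.trans (Nat.zero_le n)
  have hK2 : ∀ n, n < T (K n + 1) := by
    intro n
    by_contra hcon
    have h1 : K n + 1 ≤ n := (hTk _).trans (not_lt.1 hcon)
    exact Nat.findGreatest_is_greatest (P := fun k => T k ≤ n) (Nat.lt_succ_self (K n)) h1
      (not_lt.1 hcon)
  have hKtop : Tendsto K atTop atTop := by
    refine tendsto_atTop.2 fun k => (eventually_ge_atTop (T k)).mono fun n hn => ?_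
    exact Nat.le_findGreatest ((hTk k).trans hn) hn
  have h1 : Tendsto (fun n => (T (K n) : ℝ) / K n) atTop (𝓝 γ) := h.comp hKtop
  have h2 : Tendsto (fun n => (T (K n + 1) : ℝ) / K n) atTop (𝓝 γ) := by
    have h3 : Tendsto (fun n : ℕ => (T (n + 1) : ℝ) / n) atTop (𝓝 γ) := by
      have h4 : Tendsto (fun n : ℕ => (T (n + 1) : ℝ) / (n + 1 : ℕ)) atTop (𝓝 γ) :=
        h.comp (tendsto_add_atTop_nat 1)
      have h5 : Tendsto (fun n : ℕ => ((n + 1 : ℕ) : ℝ) / n) atTop (𝓝 1) := by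
        have h6 : Tendsto (fun n : ℕ => 1 + 1 / (n : ℝ)) atTop (𝓝 (1 + 0)) :=
          tendsto_const_nhds.add tendsto_one_div_atTop_nhds_zero_nat
        rw [add_zero] at h6
        refine h6.congr' ((eventually_gt_atTop 0).mono fun n hn => ?_)
        have : (n : ℝ) ≠ 0 := by exact_mod_cast hn.ne'
        push_cast
        field_simp
      have h7 := h4.mul h5
      rw [mul_one] at h7
      refine h7.congr fun n => ?_
      have : ((n + 1 : ℕ) : ℝ) ≠ 0 := by positivity
      field_simp
    exact h3.comp hKtop
  have h3 : Tendsto (fun n : ℕ => (n : ℝ) / K n) atTop (𝓝 γ) := by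
    refine tendsto_of_tendsto_of_tendsto_of_le_of_le h1 h2 (fun n => ?_) fun n => ?_
    · exact div_le_div_of_nonneg_right (Nat.cast_le.2 (hK1 n)) (Nat.cast_nonneg _)
    · exact div_le_div_of_nonneg_right (Nat.cast_le.2 (hK2 n).le) (Nat.cast_nonneg _)
  have h4 : Tendsto (fun n : ℕ => (K n : ℝ) / n) atTop (𝓝 (1 / γ)) := by
    have := h3.inv₀ hγ.ne'
    simpa using this
  have h5 : Tendsto (fun n : ℕ => (K n : ℝ) / n - (1 - (T (K n) : ℝ) / K n * ((K n : ℝ) / n))) atTop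
      (𝓝 (1 / γ - (1 - γ * (1 / γ)))) := h4.sub (tendsto_const_nhds.sub (h1.mul h4))
  rw [mul_one_div_cancel hγ.ne', sub_self, sub_zero] at h5
  refine tendsto_of_tendsto_of_tendsto_of_le_of_le' h5 h4 ?_ (Eventually.of_forall fun n => ?_)
  · filter_upwards [eventually_gt_atTop 0, hKtop.eventually_gt_atTop 0] with n hn hKn
    have hn' : (0 : ℝ) < n := by exact_mod_cast hn
    have hK' : (K n : ℝ) ≠ 0 := by exact_mod_cast hKn.ne'
    have h6 : (((K n : ℤ) - ((n : ℤ) - (T (K n) : ℤ)) : ℤ) : ℝ) ≤ (maximum ξ n : ℝ) :=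
      Int.cast_le.2 (le_maximum hξ (hr (K n)) (hK1 n))
    rw [div_mul_div_cancel₀ hK', le_div_iff₀ hn']
    push_cast at h6
    refine le_trans (le_of_eq ?_) h6
    field_simp
  · refine div_le_div_of_nonneg_right ?_ (Nat.cast_nonneg _)
    exact_mod_cast maximum_le hξ (hK2 n)

/-! ### The canonical probability space -/

/-- Law of a coin with values `true` (step to the right, probability `p`) and `false`. -/
noncomputable def coin (p : unitInterval) : Measure Bool :=
  ENNReal.ofReal p • Measure.dirac true + ENNReal.ofReal (1 - p) • Measure.dirac false

instance (p : unitInterval) : IsProbabilityMeasure (coin p) := by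
  refine ⟨?_⟩
  simp only [coin, Measure.add_apply, Measure.smul_apply, measure_univ, smul_eq_mul, mul_one]
  rw [← ENNReal.ofReal_add p.2.1 (sub_nonneg.2 p.2.2), add_sub_cancel, ENNReal.ofReal_one]

theorem coin_true (p : unitInterval) : coin p {true} = ENNReal.ofReal p := by
  simp [coin]

theorem coin_false (p : unitInterval) : coin p {false} = ENNReal.ofReal (1 - p) := by
  simp [coin]

theorem integral_coin (p : unitInterval) (f : Bool → ℝ) :
    ∫ b, f b ∂coin p = p * f true + (1 - p) * f false := by
  rw [integral_fintype (Integrable.of_finite)]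
  simp [Measure.real, coin_true, coin_false, p.2.1, p.2.2]

/-- Law of the coins of a single frog. -/
noncomputable def frogLaw (p : unitInterval) : Measure (ℕ → Bool) :=
  Measure.infinitePi fun _ => coin p

/-- Law of the coins of all frogs. -/
noncomputable def modelLaw (p : unitInterval) : Measure (ℤ → ℕ → Bool) :=
  Measure.infinitePi fun _ => frogLaw p

instance (p : unitInterval) : IsProbabilityMeasure (frogLaw p) := by
  unfold frogLaw; infer_instance

instance (p : unitInterval) : IsProbabilityMeasure (modelLaw p) := by
  unfold modelLaw; infer_instance

/-- The array of steps that belongs to an array of coins. -/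
def steps (ω : ℤ → ℕ → Bool) (i : ℤ) (k : ℕ) : ℤ := if ω i k then 1 else -1

theorem steps_eq (ω : ℤ → ℕ → Bool) (i : ℤ) (k : ℕ) : steps ω i k = 1 ∨ steps ω i k = -1 := by
  unfold steps; split_ifs <;> simp

theorem map_eq_coin {p : unitInterval} {Ω : Type*} [MeasurableSpace Ω] {P : Measure Ω}
    [IsProbabilityMeasure P] {X : ℤ → ℕ → Ω → ℤ} (hX : IsStepArray p P X) (i : ℤ) (k : ℕ) :
    P.map (fun ω => decide (X i k ω = 1)) = coin p := by
  have hm : Measurable fun ω => decide (X i k ω = 1) :=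
    (measurable_of_countable fun z : ℤ => decide (z = 1)).comp (hX.measurable i k)
  have : IsProbabilityMeasure (P.map fun ω => decide (X i k ω = 1)) :=
    Measure.isProbabilityMeasure_map hm.aemeasurable
  have h1 : P.map (fun ω => decide (X i k ω = 1)) {true} = coin p {true} := by
    rw [Measure.map_apply hm (measurableSet_singleton _), coin_true, ← hX.prob_right i k]
    congr 1
    ext ω
    simp
  refine Measure.ext_of_singleton fun b => ?_
  cases b with
  | true => exact h1
  | false =>
    have hc : ({false} : Set Bool) = {true}ᶜ := by ext b; simp
    rw [hc, prob_compl_eq_one_sub (measurableSet_singleton _),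
      prob_compl_eq_one_sub (measurableSet_singleton _), h1]

theorem map_eq_modelLaw {p : unitInterval} {Ω : Type*} [MeasurableSpace Ω] {P : Measure Ω}
    [IsProbabilityMeasure P] {X : ℤ → ℕ → Ω → ℤ} (hX : IsStepArray p P X) :
    P.map (fun ω i k => decide (X i k ω = 1)) = modelLaw p := by
  have hm : ∀ i k, Measurable fun ω => decide (X i k ω = 1) := fun i k =>
    (measurable_of_countable fun z : ℤ => decide (z = 1)).comp (hX.measurable i k)
  have hi := hX.indep.comp (fun _ (z : ℤ) => decide (z = 1)) fun _ => measurable_of_countable _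
  have h1 := (iIndepFun_iff_map_fun_eq_infinitePi_map (fun q : ℤ × ℕ => hm q.1 q.2)).1 hi
  have h2 : ∀ q : ℤ × ℕ, P.map (fun ω => decide (X q.1 q.2 ω = 1)) = coin p :=
    fun q => map_eq_coin hX q.1 q.2
  have h3 : (fun ω i k => decide (X i k ω = 1))
      = MeasurableEquiv.curry ℤ ℕ Bool ∘ fun ω (q : ℤ × ℕ) => decide (X q.1 q.2 ω = 1) := rfl
  have h4 : Measure.map (fun ω (q : ℤ × ℕ) => decide (X q.1 q.2 ω = 1)) P
      = Measure.infinitePi fun _ : ℤ × ℕ => coin p := by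
    refine h1.trans ?_
    congr 1
    funext q
    exact h2 q
  have h5 : Measurable fun ω (q : ℤ × ℕ) => decide (X q.1 q.2 ω = 1) :=
    measurable_pi_iff.2 fun q => hm q.1 q.2
  rw [h3, ← Measure.map_map (MeasurableEquiv.measurable _) h5, h4]
  exact Measure.infinitePi_map_curry fun _ _ => coin p

theorem ae_steps_eq {p : unitInterval} {Ω : Type*} [MeasurableSpace Ω] {P : Measure Ω}
    [IsProbabilityMeasure P] {X : ℤ → ℕ → Ω → ℤ} (hX : IsStepArray p P X) :
    ∀ᵐ ω ∂P, steps (fun i k => decide (X i k ω = 1)) = fun i k => X i k ω := by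
  have h : ∀ i k, ∀ᵐ ω ∂P, X i k ω = 1 ∨ X i k ω = -1 := by
    intro i k
    have hm : ∀ z, MeasurableSet {ω | X i k ω = z} := fun z =>
      hX.measurable i k (measurableSet_singleton z)
    have hd : Disjoint {ω | X i k ω = 1} {ω | X i k ω = -1} := by
      rw [Set.disjoint_left]
      intro ω h1 h2
      have h3 : (1 : ℤ) = -1 := h1.symm.trans h2
      omega
    refine (mem_ae_iff_prob_eq_one ((hm 1).union (hm (-1)))).2 ?_
    rw [measure_union hd (hm _), hX.prob_right, hX.prob_left,
      ← ENNReal.ofReal_add p.2.1 (sub_nonneg.2 p.2.2), add_sub_cancel, ENNReal.ofReal_one]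
  filter_upwards [ae_all_iff.2 fun i => ae_all_iff.2 (h i)] with ω hω
  funext i k
  rcases hω i k with h | h <;> simp [steps, h]

/-- Shift of the array of coins by `c` sites. -/
def shift (c : ℤ) (ω : ℤ → ℕ → Bool) : ℤ → ℕ → Bool := fun i => ω (i + c)

theorem steps_shift (c : ℤ) (ω : ℤ → ℕ → Bool) :
    steps (shift c ω) = fun x => steps ω (x + c) := rfl

theorem shift_zero (ω : ℤ → ℕ → Bool) : shift 0 ω = ω := by
  funext i; simp [shift]

theorem shift_shift (c d : ℤ) (ω : ℤ → ℕ → Bool) : shift c (shift d ω) = shift (c + d) ω := by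
  funext i; simp [shift, add_assoc]

theorem measurePreserving_shift (p : unitInterval) (c : ℤ) :
    MeasurePreserving (shift c) (modelLaw p) (modelLaw p) where
  measurable := measurable_pi_iff.2 fun _ => measurable_pi_apply _
  map_eq := Measure.map_infinitePi_infinitePi_of_inj (P := fun _ : ℤ => frogLaw p)
    (add_left_injective c)

theorem iIndepFun_frogs (p : unitInterval) :
    iIndepFun (fun (i : ℤ) (ω : ℤ → ℕ → Bool) => ω i) (modelLaw p) :=
  iIndepFun_infinitePi (P := fun _ => frogLaw p) (X := fun _ b => b) fun _ => measurable_id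

theorem measurePreserving_frog (p : unitInterval) (i : ℤ) :
    MeasurePreserving (fun ω : ℤ → ℕ → Bool => ω i) (modelLaw p) (frogLaw p) :=
  measurePreserving_eval_infinitePi (fun _ : ℤ => frogLaw p) i

theorem iIndepFun_coins (p : unitInterval) :
    iIndepFun (fun (k : ℕ) (b : ℕ → Bool) => b k) (frogLaw p) :=
  iIndepFun_infinitePi (P := fun _ => coin p) (X := fun _ b => b) fun _ => measurable_id

theorem measurePreserving_coin (p : unitInterval) (k : ℕ) :
    MeasurePreserving (fun b : ℕ → Bool => b k) (frogLaw p) (coin p) :=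
  measurePreserving_eval_infinitePi (fun _ : ℕ => coin p) k

/-- Reachability only depends on finitely many coins, so it is an open condition. -/
theorem isOpen_setOf_reach (S : Set ℤ) (i j : ℤ) (n : ℕ) :
    IsOpen {ω : ℤ → ℕ → Bool | Reach S (steps ω) i j n} := by
  have hwalk : ∀ x t, Continuous fun ω : ℤ → ℕ → Bool => walk (steps ω) x t := by
    intro x t
    unfold walk
    refine continuous_finsetSum _ fun k _ => ?_
    exact (continuous_of_discreteTopology (f := fun b : Bool => if b then (1 : ℤ) else -1)).comp
      ((continuous_apply k).comp (continuous_apply x))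
  refine isOpen_iff_mem_nhds.2 fun ω hω => ?_
  have hω' : Reach S (steps ω) i j n := hω
  change ∀ᶠ ω' in 𝓝 ω, Reach S (steps ω') i j n
  induction hω' with
  | refl => exact Eventually.of_forall fun _ => .refl
  | @step x n t h hx ih =>
    have hev : ∀ᶠ ω' in 𝓝 ω, walk (steps ω') x t = walk (steps ω) x t :=
      (hwalk x t).continuousAt.eventually_mem (isOpen_discrete {walk (steps ω) x t} |>.mem_nhds rfl)
    filter_upwards [ih h, hev] with ω' h1 h2
    rw [← h2]
    exact h1.step t hx

theorem measurableSet_reach (S : Set ℤ) (i j : ℤ) (n : ℕ) :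
    MeasurableSet {ω : ℤ → ℕ → Bool | Reach S (steps ω) i j n} :=
  (isOpen_setOf_reach S i j n).measurableSet

theorem measurable_passageTime (S : Set ℤ) (i j : ℤ) :
    Measurable fun ω : ℤ → ℕ → Bool => passageTime S (steps ω) i j := by
  have h : ∀ n, MeasurableSet {ω : ℤ → ℕ → Bool | ∃ k ≤ n, Reach S (steps ω) i j k} := fun n => by
    have : {ω : ℤ → ℕ → Bool | ∃ k ≤ n, Reach S (steps ω) i j k}
        = ⋃ k ∈ Set.Iic n, {ω | Reach S (steps ω) i j k} := by ext; simp
    rw [this]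
    exact MeasurableSet.biUnion (Set.to_countable _) fun k _ => measurableSet_reach S i j k
  have h' : MeasurableSet {ω : ℤ → ℕ → Bool | ∃ k, Reach S (steps ω) i j k} := by
    have : {ω : ℤ → ℕ → Bool | ∃ k, Reach S (steps ω) i j k}
        = ⋃ k, {ω | Reach S (steps ω) i j k} := by ext; simp
    rw [this]
    exact MeasurableSet.iUnion fun k => measurableSet_reach S i j k
  refine measurable_of_Iic fun n => ?_
  -- the passage time is at most `n` if the site is reached by then or, by the junk value, never
  have : (fun ω : ℤ → ℕ → Bool => passageTime S (steps ω) i j) ⁻¹' Set.Iic n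
      = {ω | ∃ k ≤ n, Reach S (steps ω) i j k} ∪ {ω | ∃ k, Reach S (steps ω) i j k}ᶜ := by
    ext ω
    simp only [Set.mem_preimage, Set.mem_Iic, Set.mem_union, Set.mem_ofPred_eq, Set.mem_compl_iff]
    constructor
    · intro hle
      by_cases hex : ∃ k, Reach S (steps ω) i j k
      · exact Or.inl ⟨_, hle, reach_passageTime hex⟩
      · exact Or.inr hex
    · rintro (⟨k, hk, hr⟩ | hne)
      · exact (passageTime_le hr).trans hk
      · have : {n | Reach S (steps ω) i j n} = ∅ :=
          Set.eq_empty_iff_forall_notMem.2 fun k hk => hne ⟨k, hk⟩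
        simp [passageTime, this]
  rw [this]
  exact (h n).union h'.compl

/-! ### Hitting probabilities of a single walk -/

/-- Position after `n` steps of the walk with coins `b`. -/
def height (b : ℕ → Bool) (n : ℕ) : ℤ := ∑ k ∈ Finset.range n, if b k then 1 else -1

theorem walk_steps (ω : ℤ → ℕ → Bool) (i : ℤ) (n : ℕ) : walk (steps ω) i n = height (ω i) n := rfl

theorem height_succ (b : ℕ → Bool) (n : ℕ) :
    height b (n + 1) = height b n + if b n then 1 else -1 := Finset.sum_range_succ _ _

theorem height_congr {b b' : ℕ → Bool} {n : ℕ} (h : ∀ k < n, b k = b' k) :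
    height b n = height b' n :=
  Finset.sum_congr rfl fun k hk => by rw [h k (Finset.mem_range.1 hk)]

/-- Extension of the first `n` coins by `false`. -/
def extendCoins (n : ℕ) (r : Finset.range n → Bool) (k : ℕ) : Bool :=
  if h : k ∈ Finset.range n then r ⟨k, h⟩ else false

theorem eq_comp_restrict {α : Type*} {n : ℕ} {F : (ℕ → Bool) → α}
    (hF : ∀ b b', (∀ k < n, b k = b' k) → F b = F b') :
    F = (F ∘ extendCoins n) ∘ fun b (k : Finset.range n) => b k := by
  funext b
  refine hF _ _ fun k hk => ?_
  simp [extendCoins, hk]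

theorem measurable_of_coins {α : Type*} [MeasurableSpace α] {n : ℕ} {F : (ℕ → Bool) → α}
    (hF : ∀ b b', (∀ k < n, b k = b' k) → F b = F b') : Measurable F := by
  rw [eq_comp_restrict hF]
  exact (measurable_of_countable _).comp (measurable_pi_iff.2 fun k => measurable_pi_apply _)

theorem integrable_of_coins (p : unitInterval) {n : ℕ} {F : (ℕ → Bool) → ℝ}
    (hF : ∀ b b', (∀ k < n, b k = b' k) → F b = F b') : Integrable F (frogLaw p) := by
  have hm : Measurable fun (b : ℕ → Bool) (k : Finset.range n) => b k :=
    measurable_pi_iff.2 fun k => measurable_pi_apply _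
  have := Measure.isProbabilityMeasure_map (μ := frogLaw p) hm.aemeasurable
  rw [eq_comp_restrict hF]
  exact (Integrable.of_finite (μ := (frogLaw p).map _)).comp_measurable hm

/-- The next coin is independent of the coins before. -/
theorem integral_mul_coin (p : unitInterval) {n : ℕ} {F : (ℕ → Bool) → ℝ}
    (hF : ∀ b b', (∀ k < n, b k = b' k) → F b = F b') (f : Bool → ℝ) :
    ∫ b, F b * f (b n) ∂frogLaw p
      = (∫ b, F b ∂frogLaw p) * (p * f true + (1 - p) * f false) := by
  have hi := (iIndepFun_coins p).indepFun_finset (Finset.range n) {n} (by simp)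
    fun k => measurable_pi_apply k
  have hi2 := hi.comp (φ := F ∘ extendCoins n) (ψ := fun r => f (r ⟨n, by simp⟩))
    (measurable_of_countable _) (measurable_of_countable _)
  have h1 : ((F ∘ extendCoins n) ∘ fun b (k : Finset.range n) => b k) = F :=
    (eq_comp_restrict hF).symm
  rw [h1] at hi2
  have h2 : ((fun r : ({n} : Finset ℕ) → Bool => f (r ⟨n, by simp⟩)) ∘
    fun (b : ℕ → Bool) (k : ({n} : Finset ℕ)) => b k) = fun b => f (b n) := rfl
  rw [h2] at hi2
  have hfm : Measurable fun b : ℕ → Bool => f (b n) :=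
    (measurable_of_countable f).comp (measurable_pi_apply n)
  rw [hi2.integral_fun_mul_eq_mul_integral (measurable_of_coins hF).aestronglyMeasurable
    hfm.aestronglyMeasurable]
  congr 1
  rw [← integral_coin, ← (measurePreserving_coin p n).map_eq,
    integral_map (measurable_pi_apply n).aemeasurable
      (measurable_of_countable f).aestronglyMeasurable]

/-- The walk stays below `L` during its first `n` steps. -/
def StaysBelow (L : ℤ) (n : ℕ) : Set (ℕ → Bool) := {b | ∀ k ≤ n, height b k < L}

theorem mem_staysBelow_congr {L : ℤ} {n : ℕ} {b b' : ℕ → Bool} (h : ∀ k < n, b k = b' k) :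
    b ∈ StaysBelow L n ↔ b' ∈ StaysBelow L n := by
  refine forall₂_congr fun k hk => ?_
  rw [height_congr fun j hj => h j (by omega)]

theorem measurableSet_staysBelow (L : ℤ) (n : ℕ) : MeasurableSet (StaysBelow L n) := by
  have : Measurable fun b => b ∈ StaysBelow L n :=
    measurable_of_coins (n := n) fun b b' h => propext (mem_staysBelow_congr h)
  exact measurableSet_setOfPred.2 this

open Classical in
/-- Optional stopping for the exponential martingale of the walk, at the first visit to `L`. -/
theorem one_le_of_staysBelow (p : unitInterval) {L : ℤ} (hL : 0 < L) {θ c : ℝ} (hθ : 0 < θ)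
    (hc : c = p * Real.exp θ + (1 - p) * Real.exp (-θ)) (hc1 : 1 ≤ c) (n : ℕ) :
    1 ≤ (c ^ n)⁻¹ * ∫ b, (if b ∈ StaysBelow L n then Real.exp (θ * height b n) else 0) ∂frogLaw p
      + Real.exp (θ * L) * (1 - (frogLaw p).real (StaysBelow L n)) := by
  induction n with
  | zero =>
    have h0 : StaysBelow L 0 = Set.univ := by
      ext b; simp [StaysBelow, height, hL]
    simp [h0, height]
  | succ n ih =>
    have hdep : ∀ b b' : ℕ → Bool, (∀ k < n, b k = b' k) →
        (if b ∈ StaysBelow L n then Real.exp (θ * height b n) else 0)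
          = (if b' ∈ StaysBelow L n then Real.exp (θ * height b' n) else 0) := by
      intro b b' h
      rw [height_congr h]
      simp only [mem_staysBelow_congr h]
    have hdep' : ∀ b b' : ℕ → Bool, (∀ k < n + 1, b k = b' k) →
        (if b ∈ StaysBelow L (n + 1) then Real.exp (θ * height b (n + 1)) else 0)
          = (if b' ∈ StaysBelow L (n + 1) then Real.exp (θ * height b' (n + 1)) else 0) := by
      intro b b' h
      rw [height_congr h]
      simp only [mem_staysBelow_congr h]
    have h1 := integral_mul_coin p hdep fun x => Real.exp (θ * if x then (1 : ℝ) else -1)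
    simp only [if_true, mul_one, Bool.false_eq_true, if_false, mul_neg, ← hc] at h1
    have hsub : StaysBelow L (n + 1) ⊆ StaysBelow L n := fun b hb k hk => hb k (by omega)
    have hint1 : Integrable (fun b => if b ∈ StaysBelow L (n + 1) then
        Real.exp (θ * height b (n + 1)) else 0) (frogLaw p) := integrable_of_coins p hdep'
    have hm := measurableSet_staysBelow L n
    have hm' := measurableSet_staysBelow L (n + 1)
    have hi1 : Integrable ((StaysBelow L n).indicator (1 : (ℕ → Bool) → ℝ)) (frogLaw p) :=
      (integrable_const (1 : ℝ)).indicator hm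
    have hi2 : Integrable ((StaysBelow L (n + 1)).indicator (1 : (ℕ → Bool) → ℝ)) (frogLaw p) :=
      (integrable_const (1 : ℝ)).indicator hm'
    have hint2 : Integrable (fun b => Real.exp (θ * L) *
        ((StaysBelow L n).indicator 1 b - (StaysBelow L (n + 1)).indicator 1 b)) (frogLaw p) :=
      (hi1.sub hi2).const_mul _
    have h2 : ∫ b, (if b ∈ StaysBelow L n then Real.exp (θ * height b n) else 0)
          * Real.exp (θ * if b n then (1 : ℝ) else -1) ∂frogLaw p
        ≤ ∫ b, ((if b ∈ StaysBelow L (n + 1) then Real.exp (θ * height b (n + 1)) else 0)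
          + Real.exp (θ * L) *
            ((StaysBelow L n).indicator 1 b - (StaysBelow L (n + 1)).indicator 1 b))
          ∂frogLaw p := by
      refine integral_mono (integrable_of_coins p (n := n + 1) ?_) (hint1.add hint2) fun b => ?_
      · intro b b' h
        rw [hdep b b' fun k hk => h k (by omega), h n (by omega)]
      · by_cases hb : b ∈ StaysBelow L n
        · have hh : ((height b (n + 1) : ℤ) : ℝ) = height b n + if b n then (1 : ℝ) else -1 := by
            rw [height_succ]; push_cast; rfl
          simp only [hb, if_true, ← Real.exp_add, ← mul_add, ← hh, Set.indicator_of_mem,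
            Pi.one_apply]
          by_cases hb' : b ∈ StaysBelow L (n + 1)
          · simp [hb']
          · simp only [hb', if_false, Set.indicator_of_notMem, not_false_eq_true, sub_zero,
              mul_one, zero_add]
            have h3 : height b n < L := hb n le_rfl
            have h4 : height b (n + 1) ≤ L := by
              rw [height_succ]; split_ifs <;> omega
            exact Real.exp_le_exp.2 (mul_le_mul_of_nonneg_left (by exact_mod_cast h4) hθ.le)
        · have hb' : b ∉ StaysBelow L (n + 1) := fun h => hb (hsub h)
          simp [hb, hb']
    rw [h1, integral_add hint1 hint2, integral_const_mul, integral_sub hi1 hi2,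
      integral_indicator_one hm, integral_indicator_one hm'] at h2
    have hc0 : 0 < c := by linarith
    have hcn : (c ^ (n + 1))⁻¹ ≤ 1 := inv_le_one_of_one_le₀ (one_le_pow₀ hc1)
    have hmono : (frogLaw p).real (StaysBelow L (n + 1)) ≤ (frogLaw p).real (StaysBelow L n) :=
      measureReal_mono hsub
    have h3 := mul_le_mul_of_nonneg_left h2 (inv_nonneg.2 (pow_nonneg hc0.le (n + 1)))
    have h4 : (c ^ (n + 1))⁻¹ * ((∫ b, (if b ∈ StaysBelow L n then Real.exp (θ * height b n)
        else 0) ∂frogLaw p) * c) = (c ^ n)⁻¹ * ∫ b, (if b ∈ StaysBelow L n then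
          Real.exp (θ * height b n) else 0) ∂frogLaw p := by
      rw [pow_succ]; field_simp
    rw [h4] at h3
    have h5 : (c ^ (n + 1))⁻¹ * (Real.exp (θ * L) * ((frogLaw p).real (StaysBelow L n)
        - (frogLaw p).real (StaysBelow L (n + 1)))) ≤ Real.exp (θ * L) *
          ((frogLaw p).real (StaysBelow L n) - (frogLaw p).real (StaysBelow L (n + 1))) :=
      mul_le_of_le_one_left (mul_nonneg (Real.exp_pos _).le (sub_nonneg.2 hmono)) hcn
    linarith [ih]

/-- A walk without drift to the left stays below `L` for `n` steps with a probability of order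
`n ^ (-1 / 2)` at most. -/
theorem measure_staysBelow_le (p : unitInterval) (hp : 1 / 2 ≤ (p : ℝ)) {L : ℤ} (hL : 0 < L)
    {n : ℕ} (hn : 0 < n) : (frogLaw p).real (StaysBelow L n) ≤ 3 * L / √n := by
  classical
  have hn' : (0 : ℝ) < n := by exact_mod_cast hn
  have hs : 0 < √(n : ℝ) := Real.sqrt_pos.2 hn'
  set θ : ℝ := 1 / √n with hθd
  have hθ : 0 < θ := by positivity
  have hθ2 : θ ^ 2 * n = 1 := by
    rw [hθd, div_pow, Real.sq_sqrt hn'.le]; field_simp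
  set c : ℝ := p * Real.exp θ + (1 - p) * Real.exp (-θ) with hc
  have hc2 : 1 + θ ^ 2 / 2 ≤ c := by
    have h1 : Real.exp (-θ) ≤ Real.exp θ := Real.exp_le_exp.2 (by linarith)
    have h2 : Real.cosh θ ≤ c := by
      rw [Real.cosh_eq, hc]
      nlinarith
    refine le_trans ?_ h2
    have h3 := Real.cosh_sq' (θ / 2)
    have h4 := Real.cosh_two_mul (θ / 2)
    have h5 : θ / 2 ≤ Real.sinh (θ / 2) := Real.self_le_sinh_iff.2 (by positivity)
    rw [show 2 * (θ / 2) = θ by ring] at h4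
    nlinarith
  have hc1 : 1 ≤ c := by nlinarith [sq_nonneg θ]
  have hcn : 3 / 2 ≤ c ^ n := by
    have h1 := one_add_mul_le_pow (a := θ ^ 2 / 2) (by nlinarith [sq_nonneg θ]) n
    have h2 : (1 + θ ^ 2 / 2) ^ n ≤ c ^ n := pow_le_pow_left₀ (by positivity) hc2 n
    nlinarith
  have hcinv : (c ^ n)⁻¹ ≤ 2 / 3 := by
    rw [inv_le_comm₀ (by linarith) (by norm_num)]; linarith
  have h := one_le_of_staysBelow p hL hθ hc hc1 n
  set P := (frogLaw p).real (StaysBelow L n) with hP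
  have hP0 : 0 ≤ P := measureReal_nonneg
  have hm := measurableSet_staysBelow L n
  have hI : ∫ b, (if b ∈ StaysBelow L n then Real.exp (θ * height b n) else 0) ∂frogLaw p
      ≤ Real.exp (θ * L) * P := by
    rw [hP, ← integral_indicator_one hm, ← integral_const_mul]
    refine integral_mono (integrable_of_coins p (n := n) ?_)
      (((integrable_const (1 : ℝ)).indicator hm).const_mul _) fun b => ?_
    · intro b b' h
      rw [height_congr h]
      simp only [mem_staysBelow_congr h]
    · by_cases hb : b ∈ StaysBelow L n
      · simp only [hb, if_true, Set.indicator_of_mem, Pi.one_apply, mul_one]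
        have h3 : height b n ≤ L := (hb n le_rfl).le
        exact Real.exp_le_exp.2 (mul_le_mul_of_nonneg_left (by exact_mod_cast h3) hθ.le)
      · simp [hb]
  have hE := Real.exp_pos (θ * L)
  have h6 : 1 ≤ Real.exp (θ * L) * (1 - P / 3) := by
    have h7 : (c ^ n)⁻¹ * ∫ b, (if b ∈ StaysBelow L n then Real.exp (θ * height b n) else 0)
        ∂frogLaw p ≤ 2 / 3 * (Real.exp (θ * L) * P) :=
      mul_le_mul hcinv hI (integral_nonneg fun b => by split_ifs <;> positivity) (by norm_num)
    nlinarith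
  have h8 : Real.exp (-(θ * L)) ≤ 1 - P / 3 := by
    rw [Real.exp_neg, inv_le_iff_one_le_mul₀ hE, mul_comm]
    exact h6
  have h9 := Real.add_one_le_exp (-(θ * L))
  have h10 : 3 * (L : ℝ) / √n = 3 * (θ * L) := by rw [hθd]; ring
  rw [h10]
  linarith

/-! ### The probability that there is no fast frog -/

/-- Number of steps to the left among the first `n` steps of the walk with coins `b`. -/
def falses (b : ℕ → Bool) (n : ℕ) : ℕ := ((Finset.range n).filter (fun t => b t = false)).card

theorem leftSteps_steps (ω : ℤ → ℕ → Bool) (i : ℤ) (n : ℕ) :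
    leftSteps (steps ω) i n = falses (ω i) n := by
  unfold leftSteps falses steps
  congr 1
  ext t
  cases ω i t <;> simp

theorem falses_congr {b b' : ℕ → Bool} {n : ℕ} (h : ∀ k < n, b k = b' k) :
    falses b n = falses b' n := by
  unfold falses
  congr 1
  refine Finset.filter_congr fun k hk => ?_
  rw [h k (Finset.mem_range.1 hk)]

/-- The coins of a frog that makes at most `l / m` steps to the left in its first `l + 1` steps. -/
def Fast (m l : ℕ) : Set (ℕ → Bool) := {b | m * falses b (l + 1) ≤ l}

theorem measurableSet_fast (m l : ℕ) : MeasurableSet (Fast m l) := by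
  have : Measurable fun b => b ∈ Fast m l :=
    measurable_of_coins (n := l + 1) fun b b' h => by
      change (m * falses b (l + 1) ≤ l) = (m * falses b' (l + 1) ≤ l)
      rw [falses_congr h]
  exact measurableSet_setOfPred.2 this

theorem noFastFrog_steps_iff (m : ℕ) (ω : ℤ → ℕ → Bool) (k : ℤ) :
    NoFastFrog m (steps ω) k ↔ ∀ l : ℕ, ω (k - l) ∈ (Fast m l)ᶜ := by
  simp only [NoFastFrog, leftSteps_steps, Fast, Set.mem_compl_iff, Set.mem_ofPred_eq, not_le]

theorem measure_fast_of_lt (p : unitInterval) {m l : ℕ} (h : l < m) :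
    (frogLaw p).real (Fast m l) = (p : ℝ) ^ (l + 1) := by
  have : Fast m l = Set.pi (Finset.range (l + 1)) fun _ => {true} := by
    ext b
    simp only [Fast, Set.mem_ofPred_eq, Set.mem_pi, Set.mem_singleton_iff, SetLike.mem_coe]
    constructor
    · intro hb t ht
      have h0 : falses b (l + 1) = 0 := by
        by_contra hne
        have := Nat.mul_le_mul_left m (Nat.one_le_iff_ne_zero.2 hne)
        omega
      rw [falses, Finset.card_eq_zero, Finset.filter_eq_empty_iff] at h0
      simpa using h0 ht
    · intro hb
      have h0 : falses b (l + 1) = 0 := by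
        rw [falses, Finset.card_eq_zero, Finset.filter_eq_empty_iff]
        intro t ht
        simp [hb t ht]
      simp [h0]
  rw [this, Measure.real, frogLaw, Measure.infinitePi_pi _ fun _ _ => measurableSet_singleton _]
  simp [coin_true, ENNReal.toReal_ofReal p.2.1]

/-- The exponential Chebyshev inequality for the number of steps to the left. -/
theorem measure_fast_le (p : unitInterval) (m l : ℕ) {t : ℝ} (ht : 0 ≤ t) (hm : 0 < m) :
    (frogLaw p).real (Fast m l)
      ≤ Real.exp (t * l) * (p + (1 - p) * Real.exp (-(t * m))) ^ (l + 1) := by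
  let f : Bool → ℝ := fun x => if x then 0 else 1
  let N : ℕ → (ℕ → Bool) → ℝ := fun k b => f (b k)
  have hN : ∀ b n, (∑ k ∈ Finset.range n, N k) b = falses b n := by
    intro b n
    rw [Finset.sum_apply, falses, Finset.card_filter]
    push_cast
    refine Finset.sum_congr rfl fun k _ => ?_
    cases h : b k <;> simp [N, f, h]
  have hNm : ∀ k, Measurable (N k) := fun k =>
    (measurable_of_countable f).comp (measurable_pi_apply k)
  have hind : iIndepFun N (frogLaw p) :=
    (iIndepFun_coins p).comp (fun _ => f) fun _ => measurable_of_countable _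
  have hmgf : ∀ k s, mgf (N k) (frogLaw p) s = p + (1 - p) * Real.exp s := by
    intro k s
    have h1 := integral_map (μ := frogLaw p) (φ := fun b : ℕ → Bool => b k)
      (measurable_pi_apply k).aemeasurable (f := fun x => Real.exp (s * f x))
      (measurable_of_countable _).aestronglyMeasurable
    rw [(measurePreserving_coin p k).map_eq, integral_coin] at h1
    rw [mgf, ← h1]
    simp [f]
  have hint : Integrable (fun b => Real.exp (-(t * m) * (∑ k ∈ Finset.range (l + 1), N k) b))
      (frogLaw p) :=
    integrable_of_coins p (n := l + 1) fun b b' h => by rw [hN, hN, falses_congr h]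
  have hch := measure_le_le_exp_mul_mgf (μ := frogLaw p)
    (X := ∑ k ∈ Finset.range (l + 1), N k) (t := -(t * m)) ((l : ℝ) / m)
    (neg_nonpos.2 (by positivity)) hint
  rw [hind.mgf_sum hNm, Finset.prod_congr rfl fun k _ => hmgf k _, Finset.prod_const,
    Finset.card_range, neg_neg] at hch
  have hm' : (0 : ℝ) < m := by exact_mod_cast hm
  have h2 : t * m * ((l : ℝ) / m) = t * l := by field_simp
  rw [h2] at hch
  refine le_trans (measureReal_mono fun b hb => ?_) hch
  change (∑ k ∈ Finset.range (l + 1), N k) b ≤ (l : ℝ) / m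
  rw [hN, le_div_iff₀ hm', mul_comm]
  exact_mod_cast hb

/-- A frog that is at least `m` steps away is fast only with exponentially small probability, for `m`
somewhat larger than the mean time between two steps to the left. -/
theorem measure_fast_le_exp (p : unitInterval) {q : ℝ} (hq : q = 1 - p) (hq0 : 0 < q) (hq1 : q ≤ 1)
    {m : ℕ} (hm : 9 ≤ m * q) (l : ℕ) :
    (frogLaw p).real (Fast m l) ≤ Real.exp (-(3 / 5 * q)) ^ l := by
  have hm0 : 0 < m := by
    rcases Nat.eq_zero_or_pos m with h | h
    · subst h; norm_num at hm
    · exact h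
  refine (measure_fast_le p m l (t := q / 3) (by positivity) hm0).trans ?_
  have hz : Real.exp (-(q / 3 * m)) ≤ 1 / 20 := by
    have h1 : Real.exp (-(q / 3 * m)) ≤ Real.exp (-3) := Real.exp_le_exp.2 (by linarith)
    refine h1.trans ?_
    rw [Real.exp_neg, one_div]
    refine inv_anti₀ (by norm_num) ?_
    have h2 : Real.exp 3 = Real.exp 1 ^ 3 := by rw [← Real.exp_nat_mul]; norm_num
    have h3 : (2.718 : ℝ) ≤ Real.exp 1 := by linarith [Real.exp_one_gt_d9]
    rw [h2]
    calc (20 : ℝ) ≤ 2.718 ^ 3 := by norm_num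
      _ ≤ _ := pow_le_pow_left₀ (by norm_num) h3 3
  have hp : (p : ℝ) = 1 - q := by linarith
  rw [hp, sub_sub_cancel]
  have hz0 := Real.exp_pos (-(q / 3 * m))
  set z := Real.exp (-(q / 3 * m))
  have h0 : 0 ≤ 1 - q + q * z := by nlinarith
  have h1 : 1 - q + q * z ≤ Real.exp (-(19 / 20 * q)) := by
    have := Real.add_one_le_exp (-(19 / 20 * q))
    nlinarith
  have h2 : 1 - q + q * z ≤ 1 := by nlinarith
  calc Real.exp (q / 3 * l) * (1 - q + q * z) ^ (l + 1)
      ≤ Real.exp (q / 3 * l) * (1 - q + q * z) ^ l :=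
        mul_le_mul_of_nonneg_left (pow_le_pow_of_le_one h0 h2 (Nat.le_succ l)) (Real.exp_pos _).le
    _ ≤ Real.exp (q / 3 * l) * Real.exp (-(19 / 20 * q)) ^ l :=
        mul_le_mul_of_nonneg_left (pow_le_pow_left₀ h0 h1 l) (Real.exp_pos _).le
    _ ≤ Real.exp (-(3 / 5 * q)) ^ l := by
        rw [← Real.exp_nat_mul, ← Real.exp_nat_mul, ← Real.exp_add]
        refine Real.exp_le_exp.2 ?_
        have : 0 ≤ (l : ℝ) * q := by positivity
        nlinarith

/-- The chord bound `q ^ s ≤ 1 - s * (1 - q)` for the pure runs to the right. -/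
theorem rpow_inv_le_prod {q : ℝ} (hq0 : 0 < q) (hq1 : q ≤ 1) (m : ℕ) :
    q ^ (1 / q) ≤ ∏ l ∈ Finset.range m, (1 - (1 - q) ^ (l + 1)) := by
  have h1 : ∏ l ∈ Finset.range m, q ^ ((1 - q) ^ l) ≤
      ∏ l ∈ Finset.range m, (1 - (1 - q) ^ (l + 1)) := by
    refine Finset.prod_le_prod (fun l _ => Real.rpow_nonneg hq0.le _) fun l _ => ?_
    have h2 := rpow_one_add_le_one_add_mul_self (s := -(1 - q)) (by linarith)
      (p := (1 - q) ^ l) (pow_nonneg (by linarith) l) (pow_le_one₀ (by linarith) (by linarith))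
    rw [show 1 + -(1 - q) = q by ring] at h2
    refine h2.trans (le_of_eq ?_)
    rw [pow_succ]; ring
  refine le_trans ?_ h1
  rw [← Real.rpow_sum_of_pos hq0]
  refine Real.rpow_le_rpow_of_exponent_ge hq0 hq1 ?_
  have h3 := geom_sum_mul (1 - q) m
  rw [le_div_iff₀ hq0]
  have h4 : 0 ≤ (1 - q) ^ m := pow_nonneg (by linarith) m
  nlinarith

theorem one_sub_sum_le_prod (x : ℕ → ℝ) (hx : ∀ l, 0 ≤ x l) (hx1 : ∀ l, x l ≤ 1)
    (s : Finset ℕ) : 1 - ∑ l ∈ s, x l ≤ ∏ l ∈ s, (1 - x l) := by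
  classical
  induction s using Finset.induction_on with
  | empty => simp
  | insert a s ha ih =>
    rw [Finset.sum_insert ha, Finset.prod_insert ha]
    have h1 : ∏ l ∈ s, (1 - x l) ≤ 1 :=
      Finset.prod_le_one (fun l _ => sub_nonneg.2 (hx1 l)) fun l _ => by linarith [hx l]
    nlinarith [hx a, hx1 a]

theorem sum_exp_le_half {q : ℝ} (hq0 : 0 < q) (hq1 : q ≤ 1 / 2) {m : ℕ}
    (hm : 1 / (2 * q ^ 2) + 4 / q ≤ m) (s : Finset ℕ) (hs : ∀ l ∈ s, m ≤ l) :
    ∑ l ∈ s, Real.exp (-(3 / 5 * q)) ^ l ≤ 1 / 2 := by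
  set r := Real.exp (-(3 / 5 * q)) with hr
  have hr0 : 0 < r := Real.exp_pos _
  have hr1 : r * (1 + 3 / 5 * q) ≤ 1 := by
    have h1 := Real.add_one_le_exp (3 / 5 * q)
    have h2 : r * Real.exp (3 / 5 * q) = 1 := by rw [hr, ← Real.exp_add]; simp
    nlinarith
  have hr1' : r < 1 := by nlinarith
  have hsum : HasSum (fun l => r ^ (m + l)) (r ^ m * (1 - r)⁻¹) := by
    simpa [pow_add] using (hasSum_geometric_of_lt_one hr0.le hr1').mul_left (r ^ m)
  have h1 : ∑ l ∈ s, r ^ l ≤ r ^ m * (1 - r)⁻¹ := by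
    have hinj : ∀ l ∈ s, l = m + (l - m) := fun l hl => by have := hs l hl; omega
    have h2 : ∑ l ∈ s, r ^ l = ∑ k ∈ s.image (· - m), r ^ (m + k) := by
      rw [Finset.sum_image]
      · exact Finset.sum_congr rfl fun l hl => by rw [← hinj l hl]
      · intro a ha b hb hab
        have h3 := hs a ha
        have h4 := hs b hb
        simp only at hab
        omega
    rw [h2]
    exact sum_le_hasSum _ (fun k _ => by positivity) hsum
  refine h1.trans ?_
  have hrm : r ^ m ≤ q / 4.8 := by
    have h2 : r ^ m ≤ Real.exp (-(3 / (10 * q)) - 12 / 5) := by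
      rw [hr, ← Real.exp_nat_mul]
      refine Real.exp_le_exp.2 ?_
      have h3 := mul_le_mul_of_nonneg_right hm (show 0 ≤ 3 / 5 * q by positivity)
      have h4 : (1 / (2 * q ^ 2) + 4 / q) * (3 / 5 * q) = 3 / (10 * q) + 12 / 5 := by
        field_simp; ring
      linarith
    refine h2.trans ?_
    have h3 : Real.exp (-(3 / (10 * q)) - 12 / 5)
        = (Real.exp (3 / (10 * q) - 1))⁻¹ * (Real.exp (17 / 5))⁻¹ := by
      rw [← Real.exp_neg, ← Real.exp_neg, ← Real.exp_add]
      congr 1; ring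
    have h4 : 3 / (10 * q) ≤ Real.exp (3 / (10 * q) - 1) := by
      have := Real.add_one_le_exp (3 / (10 * q) - 1)
      linarith
    have h5 : (16 : ℝ) ≤ Real.exp (17 / 5) := by
      have h6 : Real.exp 3 = Real.exp 1 ^ 3 := by rw [← Real.exp_nat_mul]; norm_num
      have h7 : (2.718 : ℝ) ≤ Real.exp 1 := by linarith [Real.exp_one_gt_d9]
      have h8 : Real.exp 3 ≤ Real.exp (17 / 5) := Real.exp_le_exp.2 (by norm_num)
      have h9 : (2.718 : ℝ) ^ 3 ≤ Real.exp 1 ^ 3 := pow_le_pow_left₀ (by norm_num) h7 3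
      have h10 : (16 : ℝ) ≤ 2.718 ^ 3 := by norm_num
      linarith
    rw [h3]
    calc (Real.exp (3 / (10 * q) - 1))⁻¹ * (Real.exp (17 / 5))⁻¹
        ≤ (3 / (10 * q))⁻¹ * 16⁻¹ := by
          gcongr
      _ = q / 4.8 := by field_simp; norm_num
  have hr2 : (1 - r)⁻¹ ≤ (1 + 3 / 5 * q) / (3 / 5 * q) := by
    rw [inv_le_comm₀ (by linarith) (by positivity), inv_div, div_le_iff₀ (by positivity)]
    nlinarith
  calc r ^ m * (1 - r)⁻¹ ≤ q / 4.8 * ((1 + 3 / 5 * q) / (3 / 5 * q)) :=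
        mul_le_mul hrm hr2 (inv_nonneg.2 (by linarith)) (by positivity)
    _ = (1 + 3 / 5 * q) / 2.88 := by field_simp; norm_num
    _ ≤ 1 / 2 := by rw [div_le_iff₀ (by norm_num)]; linarith

/-- Close frogs are fast only if they run straight to the right, distant ones almost never. -/
theorem measure_noFastFrog_ge (p : unitInterval) {q : ℝ} (hq : q = 1 - p) (hq0 : 0 < q)
    (hq1 : q ≤ 1 / 2) {m : ℕ} (hm : 1 / (2 * q ^ 2) + 4 / q + 14 ≤ m) (k : ℤ) :
    ENNReal.ofReal (q ^ (1 / q) / 2) ≤ modelLaw p {ω | NoFastFrog m (steps ω) k} := by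
  have hset : {ω | NoFastFrog m (steps ω) k}
      = ⋂ l : ℕ, {ω : ℤ → ℕ → Bool | ω (k - l) ∈ (Fast m l)ᶜ} := by
    ext ω; simp [noFastFrog_steps_iff]
  have hmeas : ∀ l : ℕ, MeasurableSet {ω : ℤ → ℕ → Bool | ω (k - l) ∈ (Fast m l)ᶜ} := fun l =>
    (measurable_pi_apply (k - (l : ℤ))) (measurableSet_fast m l).compl
  have hlim := tendsto_measure_iInter_le (μ := modelLaw p)
    (fun l => (hmeas l).nullMeasurableSet) ⟨0, measure_ne_top _ _⟩
  rw [hset]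
  refine ge_of_tendsto' hlim fun n => ?_
  have hind : iIndepFun (fun (l : ℕ) (ω : ℤ → ℕ → Bool) => ω (k - l)) (modelLaw p) :=
    (iIndepFun_frogs p).precomp (g := fun l : ℕ => k - (l : ℤ)) fun a b h => by
      simp only at h; omega
  have hprod := hind.meas_biInter (S := Finset.range (n + 1))
    (s := fun l => {ω : ℤ → ℕ → Bool | ω (k - l) ∈ (Fast m l)ᶜ})
    fun l _ => ⟨(Fast m l)ᶜ, (measurableSet_fast m l).compl, rfl⟩
  have hset2 : (⋂ j ≤ n, {ω : ℤ → ℕ → Bool | ω (k - j) ∈ (Fast m j)ᶜ})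
      = ⋂ j ∈ Finset.range (n + 1), {ω : ℤ → ℕ → Bool | ω (k - j) ∈ (Fast m j)ᶜ} := by
    simp only [Finset.mem_range, Nat.lt_succ_iff]
  rw [hset2, hprod]
  have hone : ∀ l : ℕ, modelLaw p {ω : ℤ → ℕ → Bool | ω (k - l) ∈ (Fast m l)ᶜ}
      = ENNReal.ofReal (1 - (frogLaw p).real (Fast m l)) := by
    intro l
    have h1 := (measurePreserving_frog p (k - l)).measure_preimage
      (measurableSet_fast m l).compl.nullMeasurableSet
    rw [← probReal_compl_eq_one_sub (measurableSet_fast m l), Measure.real,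
      ENNReal.ofReal_toReal (measure_ne_top _ _), ← h1]
    rfl
  have hx0 : ∀ l, 0 ≤ (frogLaw p).real (Fast m l) := fun l => measureReal_nonneg
  have hx1 : ∀ l, (frogLaw p).real (Fast m l) ≤ 1 := fun l => measureReal_le_one
  rw [Finset.prod_congr rfl fun l _ => hone l,
    ← ENNReal.ofReal_prod_of_nonneg fun l _ => sub_nonneg.2 (hx1 l)]
  refine ENNReal.ofReal_le_ofReal ?_
  have hpq : (p : ℝ) = 1 - q := by linarith
  have hmq : 9 ≤ m * q := by
    have h1 := mul_le_mul_of_nonneg_right hm hq0.le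
    have h2 : (1 / (2 * q ^ 2) + 4 / q + 14) * q = 1 / (2 * q) + 4 + 14 * q := by field_simp
    have h3 : 5 ≤ 1 / (2 * q) + 14 * q := by
      have h4 : 1 / (2 * q) + 14 * q - 5 = (28 * q ^ 2 - 10 * q + 1) / (2 * q) := by
        field_simp; ring
      have h5 : 0 ≤ (28 * q ^ 2 - 10 * q + 1) / (2 * q) :=
        div_nonneg (by nlinarith [sq_nonneg (q - 5 / 28)]) (by positivity)
      linarith
    linarith
  -- further factors only make the product smaller, so it may be taken to range beyond `m`
  have hsplit : ∏ l ∈ Finset.range (n + 1 + m), (1 - (frogLaw p).real (Fast m l))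
      ≤ ∏ l ∈ Finset.range (n + 1), (1 - (frogLaw p).real (Fast m l)) := by
    rw [Finset.prod_range_add]
    refine mul_le_of_le_one_right
      (Finset.prod_nonneg fun l _ => sub_nonneg.2 (hx1 l)) ?_
    exact Finset.prod_le_one (fun l _ => sub_nonneg.2 (hx1 _)) fun l _ => by
      linarith [hx0 (n + 1 + l)]
  refine le_trans ?_ hsplit
  rw [add_comm (n + 1) m, ← Finset.prod_range_mul_prod_Ico _ (Nat.le_add_right m (n + 1))]
  have h1 : q ^ (1 / q) ≤ ∏ l ∈ Finset.range m, (1 - (frogLaw p).real (Fast m l)) := by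
    refine (rpow_inv_le_prod hq0 (by linarith) m).trans (le_of_eq ?_)
    refine Finset.prod_congr rfl fun l hl => ?_
    rw [measure_fast_of_lt p (Finset.mem_range.1 hl), hpq]
  have h2 : 1 / 2 ≤ ∏ l ∈ Finset.Ico m (m + (n + 1)), (1 - (frogLaw p).real (Fast m l)) := by
    refine le_trans ?_ (one_sub_sum_le_prod _ hx0 hx1 _)
    have h3 : ∑ l ∈ Finset.Ico m (m + (n + 1)), (frogLaw p).real (Fast m l) ≤ 1 / 2 :=
      (Finset.sum_le_sum fun l _ => measure_fast_le_exp p hq hq0 (by linarith) hmq l).trans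
        (sum_exp_le_half hq0 hq1 (by linarith) _ fun l hl => (Finset.mem_Ico.1 hl).1)
    linarith
  calc q ^ (1 / q) / 2 = q ^ (1 / q) * (1 / 2) := by ring
    _ ≤ _ := mul_le_mul h1 h2 (by norm_num) (Finset.prod_nonneg fun l _ => sub_nonneg.2 (hx1 l))

/-- A choice of `m` for which the resulting bound on the speed is at least the required one. -/
theorem two_mul_succ_mul_rpow_le {q : ℝ} (hq0 : 0 < q) (hq1 : q < 1 / 2) {m : ℝ}
    (hm : m ≤ 1 / (2 * q ^ 2) + 4 / q + 15) :
    2 * (m + 1) * q ^ ((1 + q) * (1 - q) / (q * (1 - 2 * q))) ≤ q ^ (1 / q) := by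
  have hd : 0 < 1 - 2 * q := by linarith
  have hd' := hd.ne'
  have hexp : (1 + q) * (1 - q) / (q * (1 - 2 * q))
      = 1 / q + (2 + 3 * q / (1 - 2 * q)) := by
    have h1 : 1 / q * q = 1 := div_mul_cancel₀ _ hq0.ne'
    have h2 : 3 * q / (1 - 2 * q) * (1 - 2 * q) = 3 * q := div_mul_cancel₀ _ hd'
    rw [div_eq_iff (mul_ne_zero hq0.ne' hd')]
    linear_combination -(1 - 2 * q) * h1 - q * h2
  -- the tangent line of the logarithm at `3 / 16`
  have hlog : 8 / 3 * (1 - 2 * q) ≤ -Real.log q := by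
    have h1 : Real.log (16 / 3 * q) ≤ 16 / 3 * q - 1 := Real.log_le_sub_one_of_pos (by positivity)
    rw [Real.log_mul (by norm_num) hq0.ne'] at h1
    have h2 : (5 / 3 : ℝ) ≤ Real.log (16 / 3) := by
      rw [Real.le_log_iff_exp_le (by norm_num)]
      have h3 : Real.exp (5 / 3) ^ 3 = Real.exp 1 ^ 5 := by
        rw [← Real.exp_nat_mul, ← Real.exp_nat_mul]; norm_num
      have h4 : Real.exp 1 ^ 5 ≤ (2.7182818286 : ℝ) ^ 5 :=
        pow_le_pow_left₀ (Real.exp_pos _).le Real.exp_one_lt_d9.le 5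
      have h6 : (2.7182818286 : ℝ) ^ 5 ≤ (16 / 3) ^ 3 := by norm_num
      by_contra hcon
      have h5 : (16 / 3 : ℝ) ^ 3 < Real.exp (5 / 3) ^ 3 :=
        pow_lt_pow_left₀ (not_le.1 hcon) (by norm_num) (by norm_num)
      rw [h3] at h5
      linarith
    linarith
  have h1 : q ^ (3 * q / (1 - 2 * q)) ≤ Real.exp (-(8 * q)) := by
    rw [Real.rpow_def_of_pos hq0]
    refine Real.exp_le_exp.2 ?_
    have h2 : 0 ≤ 3 * q / (1 - 2 * q) := by positivity
    have h3 := mul_le_mul_of_nonneg_left hlog h2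
    have h4 : 3 * q / (1 - 2 * q) * (8 / 3 * (1 - 2 * q)) = 8 * q := by
      linear_combination 8 / 3 * div_mul_cancel₀ (3 * q) hd'
    nlinarith
  have h2 : 2 * (m + 1) * q ^ 2 ≤ Real.exp (8 * q) := by
    have h3 := Real.quadratic_le_exp_of_nonneg (x := 8 * q) (by positivity)
    refine le_trans ?_ h3
    have h4 : 2 * (1 / (2 * q ^ 2) + 4 / q + 15 + 1) * q ^ 2 = 1 + 8 * q + 32 * q ^ 2 := by
      field_simp; ring
    have h5 : 2 * (m + 1) * q ^ 2 ≤ 2 * (1 / (2 * q ^ 2) + 4 / q + 15 + 1) * q ^ 2 := by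
      gcongr
    nlinarith
  rw [hexp, Real.rpow_add hq0, Real.rpow_add hq0]
  have h3 : q ^ (2 : ℝ) = q ^ 2 := by exact_mod_cast Real.rpow_natCast q 2
  rw [h3]
  have h4 : 2 * (m + 1) * q ^ 2 * q ^ (3 * q / (1 - 2 * q)) ≤ 1 := by
    have h5 : 0 < q ^ (3 * q / (1 - 2 * q)) := Real.rpow_pos_of_pos hq0 _
    calc 2 * (m + 1) * q ^ 2 * q ^ (3 * q / (1 - 2 * q))
        ≤ Real.exp (8 * q) * q ^ (3 * q / (1 - 2 * q)) := mul_le_mul_of_nonneg_right h2 h5.le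
      _ ≤ Real.exp (8 * q) * Real.exp (-(8 * q)) :=
          mul_le_mul_of_nonneg_left h1 (Real.exp_pos _).le
      _ = 1 := by rw [← Real.exp_add]; simp
  have h5 : 0 < q ^ (1 / q) := Real.rpow_pos_of_pos hq0 _
  calc 2 * (m + 1) * (q ^ (1 / q) * (q ^ 2 * q ^ (3 * q / (1 - 2 * q))))
      = q ^ (1 / q) * (2 * (m + 1) * q ^ 2 * q ^ (3 * q / (1 - 2 * q))) := by ring
    _ ≤ q ^ (1 / q) * 1 := mul_le_mul_of_nonneg_left h4 h5.le
    _ = _ := mul_one _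

/-! ### Integrability of the passage time to a neighbour -/

/-- None of the first `J` blocks of three consecutive steps consists of steps to the left. -/
def NoLeftBlock (J : ℕ) : Set (ℕ → Bool) :=
  {b | ∀ j < J, ¬ (b (3 * j) = false ∧ b (3 * j + 1) = false ∧ b (3 * j + 2) = false)}

theorem mem_noLeftBlock_congr {J : ℕ} {b b' : ℕ → Bool} (h : ∀ k < 3 * J, b k = b' k) :
    b ∈ NoLeftBlock J ↔ b' ∈ NoLeftBlock J := by
  refine forall₂_congr fun j hj => ?_
  rw [h _ (by omega), h _ (by omega), h _ (by omega)]

theorem measurableSet_noLeftBlock (J : ℕ) : MeasurableSet (NoLeftBlock J) := by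
  have : Measurable fun b => b ∈ NoLeftBlock J :=
    measurable_of_coins (n := 3 * J) fun b b' h => propext (mem_noLeftBlock_congr h)
  exact measurableSet_setOfPred.2 this

theorem measure_noLeftBlock (p : unitInterval) (J : ℕ) :
    (frogLaw p).real (NoLeftBlock J) = (1 - (1 - (p : ℝ)) ^ 3) ^ J := by
  classical
  induction J with
  | zero =>
    have : NoLeftBlock 0 = Set.univ := by ext; simp [NoLeftBlock]
    simp [this]
  | succ J ih =>
    let g : Bool → ℝ := fun x => if x then 0 else 1
    let F : (ℕ → Bool) → ℝ := fun b => if b ∈ NoLeftBlock J then 1 else 0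
    have hF0 : ∀ b b' : ℕ → Bool, (∀ k < 3 * J, b k = b' k) → F b = F b' := by
      intro b b' h
      simp only [F, mem_noLeftBlock_congr h]
    have hF1 : ∀ b b' : ℕ → Bool, (∀ k < 3 * J + 1, b k = b' k) →
        F b * g (b (3 * J)) = F b' * g (b' (3 * J)) := by
      intro b b' h
      rw [hF0 b b' fun k hk => h k (by omega), h _ (by omega)]
    have hF2 : ∀ b b' : ℕ → Bool, (∀ k < 3 * J + 2, b k = b' k) →
        F b * g (b (3 * J)) * g (b (3 * J + 1)) = F b' * g (b' (3 * J)) * g (b' (3 * J + 1)) := by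
      intro b b' h
      rw [hF1 b b' fun k hk => h k (by omega), h _ (by omega)]
    have hF3 : ∀ b b' : ℕ → Bool, (∀ k < 3 * J + 3, b k = b' k) →
        F b * g (b (3 * J)) * g (b (3 * J + 1)) * g (b (3 * J + 2))
          = F b' * g (b' (3 * J)) * g (b' (3 * J + 1)) * g (b' (3 * J + 2)) := by
      intro b b' h
      rw [hF2 b b' fun k hk => h k (by omega), h _ (by omega)]
    have h0 : ∫ b, F b ∂frogLaw p = (frogLaw p).real (NoLeftBlock J) := by
      rw [← integral_indicator_one (measurableSet_noLeftBlock J)]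
      rfl
    have h3 : ∫ b, F b * g (b (3 * J)) * g (b (3 * J + 1)) * g (b (3 * J + 2)) ∂frogLaw p
        = (frogLaw p).real (NoLeftBlock J) * (1 - p) ^ 3 := by
      rw [integral_mul_coin p hF2 g, integral_mul_coin p hF1 g, integral_mul_coin p hF0 g, h0]
      simp only [g, if_true, Bool.false_eq_true, if_false]
      ring
    have h4 : (frogLaw p).real (NoLeftBlock (J + 1))
        = ∫ b, (F b - F b * g (b (3 * J)) * g (b (3 * J + 1)) * g (b (3 * J + 2))) ∂frogLaw p := by
      rw [← integral_indicator_one (measurableSet_noLeftBlock (J + 1))]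
      refine integral_congr_ae (Eventually.of_forall fun b => ?_)
      have hiff : b ∈ NoLeftBlock (J + 1) ↔ b ∈ NoLeftBlock J ∧
          ¬ (b (3 * J) = false ∧ b (3 * J + 1) = false ∧ b (3 * J + 2) = false) := by
        constructor
        · exact fun h => ⟨fun j hj => h j (by omega), h J (by omega)⟩
        · rintro ⟨h1, h2⟩ j hj
          rcases Nat.lt_succ_iff_lt_or_eq.1 hj with h | rfl
          · exact h1 j h
          · exact h2
      by_cases hb : b ∈ NoLeftBlock J
      · rcases hx : b (3 * J) <;> rcases hy : b (3 * J + 1) <;> rcases hz : b (3 * J + 2) <;>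
          simp [F, g, hiff, hb, hx, hy, hz, Set.indicator]
      · simp [F, hiff, hb, Set.indicator]
    rw [h4, integral_sub (integrable_of_coins p hF0) (integrable_of_coins p hF3), h0, h3, ih]
    ring

/-- The frogs `-3, -2, -1, 0` do not arrive at the site `1` up to the time `6 * J`. -/
def Slow (J : ℕ) : Set (ℤ → ℕ → Bool) :=
  {ω | ¬ ∃ n ≤ 6 * J, Reach (Set.Icc (-3) 0) (steps ω) 0 1 n}

/-- After three steps to the left in a row, the frog `0` has visited the site `1` or has woken up the
frogs `-1, -2, -3`. -/
theorem slow_subset (J : ℕ) :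
    Slow J ⊆ {ω | ω 0 ∈ NoLeftBlock J} ∪
      ⋂ i ∈ Finset.range 3, {ω : ℤ → ℕ → Bool | ω (-1 - (i : ℕ)) ∈ StaysBelow (2 + (i : ℕ)) (3 * J)} := by
  intro ω hω
  by_contra hcon
  simp only [Set.mem_union, not_or, Set.mem_iInter, not_forall] at hcon
  obtain ⟨h1, i, hi, h2⟩ := hcon
  apply hω
  have hi3 : i < 3 := Finset.mem_range.1 hi
  simp only [NoLeftBlock, Set.mem_ofPred_eq, not_forall, not_not] at h1
  obtain ⟨j, hj, hb0, hb1, hb2⟩ := h1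
  simp only [StaysBelow, Set.mem_ofPred_eq, not_forall, not_lt] at h2
  obtain ⟨t, ht, hLt⟩ := h2
  by_cases hhit : 1 ≤ walk (steps ω) 0 (3 * j)
  · obtain ⟨s, hs, hs'⟩ := exists_walk_eq (steps_eq ω) (k := 1) (x := 0) (by omega)
      (t := 3 * j) (by omega)
    exact ⟨s, by omega, Reach.single (by simp) hs'⟩
  · have hend : walk (steps ω) 0 (3 * j + 3) ≤ -3 := by
      rw [walk_succ, walk_succ, walk_succ]
      simp only [steps, hb0, hb1, hb2, Bool.false_eq_true, if_false]
      omega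
    -- apply the intermediate value property to the reflected walk
    have hrefl : ∀ n, walk (fun i k => -steps ω i k) 0 n = -walk (steps ω) 0 n := fun n => by
      simp [walk, Finset.sum_neg_distrib]
    obtain ⟨s, hs, hs'⟩ := exists_walk_eq (ξ := fun i k => -steps ω i k)
      (fun i k => by rcases steps_eq ω i k with h | h <;> simp [h])
      (k := 1 + i) (x := 0) (by omega) (t := 3 * j + 3) (by rw [hrefl]; omega)
    rw [hrefl] at hs'
    obtain ⟨u, hu, hu'⟩ := exists_walk_eq (steps_eq ω) (k := 1) (x := -1 - (i : ℕ)) (by omega)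
      (t := t) (by rw [walk_steps]; omega)
    have hr1 : Reach (Set.Icc (-3) 0) (steps ω) 0 (-1 - (i : ℕ)) s :=
      Reach.single (by simp) (by omega)
    exact ⟨s + u, by omega, hr1.trans (Reach.single (Set.mem_Icc.2 ⟨by omega, by omega⟩) hu')⟩

theorem measure_slow_le (p : unitInterval) (hp : 1 / 2 ≤ (p : ℝ)) (J : ℕ) :
    modelLaw p (Slow (J + 1)) ≤ ENNReal.ofReal
      ((1 - (1 - (p : ℝ)) ^ 3) ^ (J + 1) + 12 ^ 3 * (1 / ((J + 1 : ℕ) : ℝ) ^ (3 / 2 : ℝ))) := by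
  have hq0 : 0 ≤ 1 - (p : ℝ) := sub_nonneg.2 p.2.2
  have hr0 : 0 ≤ 1 - (1 - (p : ℝ)) ^ 3 := sub_nonneg.2 (pow_le_one₀ hq0 (by linarith [p.2.1]))
  rw [ENNReal.ofReal_add (by positivity) (by positivity)]
  refine (measure_mono (slow_subset (J + 1))).trans ((measure_union_le _ _).trans
    (add_le_add ?_ ?_))
  · have h1 := (measurePreserving_frog p 0).measure_preimage
      (measurableSet_noLeftBlock (J + 1)).nullMeasurableSet
    rw [← measure_noLeftBlock, Measure.real, ENNReal.ofReal_toReal (measure_ne_top _ _), ← h1]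
    rfl
  · have hind : iIndepFun (fun (l : ℕ) (ω : ℤ → ℕ → Bool) => ω (-1 - l)) (modelLaw p) :=
      (iIndepFun_frogs p).precomp (g := fun l : ℕ => -1 - (l : ℤ)) fun a b h => by
        simp only at h; omega
    have hprod := hind.meas_biInter (S := Finset.range 3)
      (s := fun l => {ω : ℤ → ℕ → Bool | ω (-1 - l) ∈ StaysBelow (2 + l) (3 * (J + 1))})
      fun l _ => ⟨_, measurableSet_staysBelow (2 + l) (3 * (J + 1)), rfl⟩
    rw [hprod]
    set x : ℝ := ((J + 1 : ℕ) : ℝ) with hx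
    have hx0 : 0 < x := by positivity
    have hone : ∀ l ∈ Finset.range 3, modelLaw p {ω : ℤ → ℕ → Bool | ω (-1 - (l : ℕ)) ∈
        StaysBelow (2 + (l : ℕ)) (3 * (J + 1))} ≤ ENNReal.ofReal (12 / √x) := by
      intro l hl
      have hl3 : l ≤ 2 := by have := Finset.mem_range.1 hl; omega
      have hl3' : (l : ℝ) ≤ 2 := by exact_mod_cast hl3
      have h1 := (measurePreserving_frog p (-1 - l)).measure_preimage
        (measurableSet_staysBelow (2 + l) (3 * (J + 1))).nullMeasurableSet
      have h2 := measure_staysBelow_le p hp (L := 2 + l) (by omega) (n := 3 * (J + 1)) (by omega)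
      change modelLaw p ((fun ω : ℤ → ℕ → Bool => ω (-1 - l)) ⁻¹' _) ≤ _
      rw [h1, ← ENNReal.ofReal_toReal (measure_ne_top (frogLaw p) _)]
      refine ENNReal.ofReal_le_ofReal (h2.trans ?_)
      have h3 : √x ≤ √((3 * (J + 1) : ℕ) : ℝ) := Real.sqrt_le_sqrt (by
        rw [hx]; push_cast; linarith [Nat.cast_nonneg (α := ℝ) J])
      have h4 : 0 < √x := Real.sqrt_pos.2 hx0
      push_cast at h3 ⊢
      exact div_le_div₀ (by norm_num) (by linarith) h4 h3
    refine (Finset.prod_le_prod' hone).trans (le_of_eq ?_)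
    rw [Finset.prod_const, Finset.card_range, ← ENNReal.ofReal_pow (by positivity), div_pow]
    congr 1
    have h5 : √x ^ 3 = x ^ (3 / 2 : ℝ) := by
      rw [Real.sqrt_eq_rpow, ← Real.rpow_natCast, ← Real.rpow_mul hx0.le]; norm_num
    rw [h5]
    ring

theorem tsum_measure_slow_ne_top (p : unitInterval) (hp : 1 / 2 ≤ (p : ℝ)) (hp1 : (p : ℝ) < 1) :
    ∑' J, modelLaw p (Slow J) ≠ ⊤ := by
  have hq0 : 0 < (1 - (p : ℝ)) ^ 3 := pow_pos (sub_pos.2 hp1) 3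
  have hq1 : (1 - (p : ℝ)) ^ 3 ≤ 1 := pow_le_one₀ (by linarith) (by linarith [p.2.1])
  have h1 : Summable fun J : ℕ => (1 - (1 - (p : ℝ)) ^ 3) ^ (J + 1) :=
    (summable_nat_add_iff 1).2 (summable_geometric_of_lt_one (by linarith) (by linarith))
  have h2 : Summable fun J : ℕ => 12 ^ 3 * (1 / ((J + 1 : ℕ) : ℝ) ^ (3 / 2 : ℝ)) :=
    ((summable_nat_add_iff 1).2
      (Real.summable_one_div_nat_rpow.2 (by norm_num : (1 : ℝ) < 3 / 2))).mul_left _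
  rw [tsum_eq_zero_add' ENNReal.summable]
  refine ENNReal.add_ne_top.2 ⟨measure_ne_top _ _, ?_⟩
  exact ne_top_of_le_ne_top (h1.add h2).tsum_ofReal_ne_top
    (ENNReal.tsum_le_tsum fun J => measure_slow_le p hp J)

/-- The neighbours on the right can be reached from every site with the help of the three sites on
the left. -/
def Connected (ω : ℤ → ℕ → Bool) : Prop :=
  ∀ i : ℤ, ∃ n, Reach (Set.Icc (i - 3) i) (steps ω) i (i + 1) n

theorem Connected.comp_shift {ω : ℤ → ℕ → Bool} (h : Connected ω) (c : ℤ) : Connected (shift c ω) := by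
  intro i
  obtain ⟨n, hn⟩ := h (i + c)
  refine ⟨n, ?_⟩
  rw [steps_shift, reach_translate_iff]
  rw [add_right_comm] at hn
  refine hn.mono fun x hx => ?_
  rw [Set.mem_Icc] at hx
  rw [Set.mem_preimage, Set.mem_Icc]
  omega

theorem Connected.exists_reach {ω : ℤ → ℕ → Bool} (h : Connected ω) {S : Set ℤ} {i j : ℤ}
    (hij : i ≤ j) (hS : Set.Icc (i - 3) j ⊆ S) : ∃ n, Reach S (steps ω) i j n := by
  obtain ⟨d, rfl⟩ : ∃ d : ℕ, j = i + d := ⟨(j - i).toNat, by omega⟩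
  clear hij
  induction d with
  | zero => exact ⟨0, by simpa using Reach.refl⟩
  | succ d ih =>
    obtain ⟨n, hn⟩ := ih ((Set.Icc_subset_Icc_right (by push_cast; omega)).trans hS)
    obtain ⟨m, hm⟩ := h (i + d)
    refine ⟨n + m, ?_⟩
    have h1 := hn.trans (hm.mono ((Set.Icc_subset_Icc (by omega) (by push_cast; omega)).trans hS))
    rwa [add_assoc] at h1

theorem ae_connected (p : unitInterval) (hp : 1 / 2 ≤ (p : ℝ)) (hp1 : (p : ℝ) < 1) :
    ∀ᵐ ω ∂modelLaw p, Connected ω := by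
  have h0 : ∀ᵐ ω ∂modelLaw p, ∃ n, Reach (Set.Icc (-3) 0) (steps ω) 0 1 n := by
    have h1 := ae_eventually_notMem (tsum_measure_slow_ne_top p hp hp1)
    filter_upwards [h1] with ω hω
    obtain ⟨J, hJ⟩ := hω.exists
    obtain ⟨n, -, hn⟩ := not_not.1 hJ
    exact ⟨n, hn⟩
  refine ae_all_iff.2 fun i => ?_
  filter_upwards [(measurePreserving_shift p i).quasiMeasurePreserving.ae h0] with ω ⟨n, hn⟩
  refine ⟨n, ?_⟩
  rw [steps_shift, reach_translate_iff, zero_add, add_comm 1 i] at hn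
  refine hn.mono fun x hx => ?_
  rw [Set.mem_preimage, Set.mem_Icc] at hx
  exact Set.mem_Icc.2 ⟨by omega, by omega⟩

theorem lintegral_passageTime_one_ne_top (p : unitInterval) (hp : 1 / 2 ≤ (p : ℝ))
    (hp1 : (p : ℝ) < 1) :
    ∫⁻ ω, (passageTime (Set.Icc (-3) 0) (steps ω) 0 1 : ENNReal) ∂modelLaw p ≠ ⊤ := by
  have hmeas : ∀ J, MeasurableSet (Slow J) := fun J => by
    have : Slow J = (⋃ n ∈ Set.Iic (6 * J), {ω | Reach (Set.Icc (-3) 0) (steps ω) 0 1 n})ᶜ := by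
      ext; simp [Slow]
    rw [this]
    exact (MeasurableSet.biUnion (Set.to_countable _)
      fun n _ => measurableSet_reach _ _ _ n).compl
  have hle : ∀ ω, (passageTime (Set.Icc (-3) 0) (steps ω) 0 1 : ENNReal)
      ≤ ∑' J, 6 * (Slow J).indicator 1 ω := by
    intro ω
    set T := passageTime (Set.Icc (-3) 0) (steps ω) 0 1 with hT
    refine le_trans ?_ (ENNReal.sum_le_tsum (Finset.range ((T + 5) / 6)))
    have h1 : ∀ J ∈ Finset.range ((T + 5) / 6),
        6 * (Slow J).indicator (1 : (ℤ → ℕ → Bool) → ENNReal) ω = 6 := by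
      intro J hJ
      have hJ' := Finset.mem_range.1 hJ
      have : ω ∈ Slow J := by
        rintro ⟨n, hn, hr⟩
        have := passageTime_le hr
        omega
      simp [this]
    rw [Finset.sum_congr rfl h1, Finset.sum_const, Finset.card_range, nsmul_eq_mul]
    have : T ≤ (T + 5) / 6 * 6 := by omega
    exact_mod_cast this
  refine ne_top_of_le_ne_top ?_ (lintegral_mono hle)
  rw [lintegral_tsum fun J => ((measurable_one.indicator (hmeas J)).const_mul _).aemeasurable]
  have : ∀ J, ∫⁻ ω, 6 * (Slow J).indicator 1 ω ∂modelLaw p = 6 * modelLaw p (Slow J) := fun J => by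
    rw [lintegral_const_mul _ (measurable_one.indicator (hmeas J)),
      lintegral_indicator_one (hmeas J)]
  simp only [this]
  rw [ENNReal.tsum_mul_left]
  exact ENNReal.mul_ne_top (by norm_num) (tsum_measure_slow_ne_top p hp hp1)

theorem measurable_passageTime_ennreal (S : Set ℤ) (i j : ℤ) :
    Measurable fun ω : ℤ → ℕ → Bool => (passageTime S (steps ω) i j : ENNReal) :=
  (measurable_of_countable fun n : ℕ => (n : ENNReal)).comp (measurable_passageTime S i j)

theorem lintegral_passageTime_ne_top (p : unitInterval) (hp : 1 / 2 ≤ (p : ℝ)) (hp1 : (p : ℝ) < 1)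
    {S : Set ℤ} (N : ℕ) (hS : Set.Icc (-3) (N : ℤ) ⊆ S) :
    ∫⁻ ω, (passageTime S (steps ω) 0 N : ENNReal) ∂modelLaw p ≠ ⊤ := by
  induction N with
  | zero => simp [passageTime_self]
  | succ N ih =>
    have hS' : Set.Icc (-3) (N : ℤ) ⊆ S :=
      (Set.Icc_subset_Icc_right (by push_cast; omega)).trans hS
    have hle : ∀ᵐ ω ∂modelLaw p, (passageTime S (steps ω) 0 (N + 1 : ℕ) : ENNReal)
        ≤ passageTime S (steps ω) 0 N
          + passageTime (Set.Icc (-3) 0) (steps (shift N ω)) 0 1 := by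
      filter_upwards [ae_connected p hp hp1] with ω hω
      have h1 := hω.exists_reach (S := S) (i := 0) (j := N) (by omega) (by simpa using hS')
      have h2 : ∃ n, Reach ((· - (N : ℤ)) ⁻¹' Set.Icc (-3) 0) (steps ω) (0 + N) (1 + N) n := by
        have h3 := (hω.comp_shift N) 0
        simpa [steps_shift, reach_translate_iff] using h3
      have hsub : (· - (N : ℤ)) ⁻¹' Set.Icc (-3) 0 ⊆ S := fun x hx => by
        rw [Set.mem_preimage, Set.mem_Icc] at hx
        exact hS (Set.mem_Icc.2 ⟨by omega, by push_cast; omega⟩)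
      rw [steps_shift, passageTime_translate]
      obtain ⟨n, hn⟩ := h2
      have h4 : ∃ n, Reach S (steps ω) N (N + 1 : ℕ) n := ⟨n, by
        have := hn.mono hsub
        rw [zero_add, add_comm] at this
        exact_mod_cast this⟩
      have h5 := passageTime_triangle h1 h4
      have h6 := passageTime_mono hsub ⟨n, hn⟩
      rw [zero_add, add_comm 1 (N : ℤ)] at h6 ⊢
      push_cast at h5 ⊢
      exact_mod_cast h5.trans (Nat.add_le_add_left h6 _)
    refine ne_top_of_le_ne_top ?_ (lintegral_mono_ae hle)
    rw [lintegral_add_left (measurable_passageTime_ennreal S 0 N)]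
    refine ENNReal.add_ne_top.2 ⟨ih hS', ?_⟩
    rw [(measurePreserving_shift p N).lintegral_comp
      (f := fun ω => (passageTime (Set.Icc (-3) 0) (steps ω) 0 1 : ENNReal))
      (measurable_passageTime_ennreal _ 0 1)]
    exact lintegral_passageTime_one_ne_top p hp hp1

/-! ### The upper bound for the passage times -/

/-- Functions of the frogs in two disjoint finite windows are independent. -/
theorem indepFun_of_windows (p : unitInterval) {Y Z : (ℤ → ℕ → Bool) → ℝ} (hY : Measurable Y)
    (hZ : Measurable Z) {S T : Finset ℤ} (hST : Disjoint S T)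
    (hYS : ∀ ω ω', (∀ i ∈ S, ω i = ω' i) → Y ω = Y ω')
    (hZT : ∀ ω ω', (∀ i ∈ T, ω i = ω' i) → Z ω = Z ω') : IndepFun Y Z (modelLaw p) := by
  have hi := (iIndepFun_frogs p).indepFun_finset S T hST fun i => measurable_pi_apply i
  let ext : (U : Finset ℤ) → (U → ℕ → Bool) → ℤ → ℕ → Bool := fun U r i =>
    if h : i ∈ U then r ⟨i, h⟩ else fun _ => false
  have hext : ∀ U : Finset ℤ, Measurable (ext U) := by
    intro U
    refine measurable_pi_iff.2 fun i => ?_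
    by_cases h : i ∈ U
    · simp only [ext, h, dif_pos]
      exact measurable_pi_apply _
    · simp only [ext, h, dif_neg, not_false_eq_true]
      exact measurable_const
  have h1 : (Y ∘ ext S) ∘ (fun ω (i : S) => ω i) = Y := by
    funext ω
    exact hYS _ _ fun i hi => by simp [ext, hi]
  have h2 : (Z ∘ ext T) ∘ (fun ω (i : T) => ω i) = Z := by
    funext ω
    exact hZT _ _ fun i hi => by simp [ext, hi]
  have h3 := hi.comp (hY.comp (hext S)) (hZ.comp (hext T))
  rwa [h1, h2] at h3

theorem measurable_shift (c : ℤ) : Measurable (shift c) :=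
  measurable_pi_iff.2 fun _ => measurable_pi_apply _

/-- Strong law of large numbers for the shifts of a function of finitely many frogs, along an
arithmetic progression whose difference exceeds the length of the window. -/
theorem ae_tendsto_sum_shift (p : unitInterval) {Y : (ℤ → ℕ → Bool) → ℝ} (hY : Measurable Y)
    (hint : Integrable Y (modelLaw p)) {K : ℤ}
    (hloc : ∀ ω ω', (∀ i ∈ Finset.Icc (-K) K, ω i = ω' i) → Y ω = Y ω') {d : ℤ} (hd : 2 * K < d)
    (hd0 : 0 < d) (a : ℤ) :
    ∀ᵐ ω ∂modelLaw p, Tendsto (fun n : ℕ => (∑ t ∈ Finset.range n, Y (shift (a + d * t) ω)) / n)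
      atTop (𝓝 (∫ ω, Y ω ∂modelLaw p)) := by
  let X : ℕ → (ℤ → ℕ → Bool) → ℝ := fun t ω => Y (shift (a + d * t) ω)
  have hX : ∀ t, Measurable (X t) := fun t => hY.comp (measurable_shift _)
  have hid : ∀ t, IdentDistrib (X t) Y (modelLaw p) (modelLaw p) := fun t =>
    ⟨(hX t).aemeasurable, hY.aemeasurable, by
      change Measure.map (Y ∘ shift (a + d * t)) _ = _
      rw [← Measure.map_map hY (measurable_shift _), (measurePreserving_shift p _).map_eq]⟩
  have hwin : ∀ t : ℕ, ∀ ω ω', (∀ i ∈ Finset.Icc (a + d * t - K) (a + d * t + K), ω i = ω' i) →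
      X t ω = X t ω' := by
    intro t ω ω' h
    refine hloc _ _ fun i hi => h _ ?_
    rw [Finset.mem_Icc] at hi ⊢
    omega
  have hind : Pairwise (Function.onFun (IndepFun · · (modelLaw p)) X) := by
    intro s t hst
    refine indepFun_of_windows p (hX s) (hX t) ?_ (hwin s) (hwin t)
    rw [Finset.disjoint_left]
    intro i his hit
    rw [Finset.mem_Icc] at his hit
    rcases lt_or_gt_of_ne hst with h | h
    · have : d * ((s : ℤ) + 1) ≤ d * t := mul_le_mul_of_nonneg_left (by omega) hd0.le
      linarith
    · have : d * ((t : ℤ) + 1) ≤ d * s := mul_le_mul_of_nonneg_left (by omega) hd0.le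
      linarith
  have h := strong_law_ae_real X ((hid 0).integrable_iff.2 hint) hind
    fun t => (hid t).trans (hid 0).symm
  rw [(hid 0).integral_eq] at h
  exact h

theorem Connected.monotone {ω : ℤ → ℕ → Bool} (h : Connected ω) {m n : ℕ} (hmn : m ≤ n) :
    passageTime Set.univ (steps ω) 0 m ≤ passageTime Set.univ (steps ω) 0 n := by
  have h1 := passageTime_le_of_le (steps_eq ω)
    (h.exists_reach (S := Set.univ) (i := 0) (j := n) (by omega) (Set.subset_univ _))
    (k := m) (by omega) (by omega)
  omega

/-- The passage time from `0` to `m + n` is at most the one to `m` plus the one of the shifted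
configuration to `n`, in which the frogs may be restricted to a window. -/
theorem Connected.passageTime_add_le {ω : ℤ → ℕ → Bool} (h : Connected ω) {S : Set ℤ} (m n : ℕ)
    (hS : Set.Icc (-3) (n : ℤ) ⊆ S) :
    passageTime Set.univ (steps ω) 0 (m + n : ℕ)
      ≤ passageTime Set.univ (steps ω) 0 m + passageTime S (steps (shift m ω)) 0 n := by
  have h1 := h.exists_reach (S := Set.univ) (i := 0) (j := m) (by omega) (Set.subset_univ _)
  have h2 := h.exists_reach (S := Set.univ) (i := m) (j := (m + n : ℕ)) (by push_cast; omega)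
    (Set.subset_univ _)
  obtain ⟨k, hk⟩ := (h.comp_shift m).exists_reach (S := S) (i := 0) (j := n) (by omega) (by simpa using hS)
  refine (passageTime_triangle h1 h2).trans (Nat.add_le_add_left ?_ _)
  rw [steps_shift, reach_translate_iff] at hk
  rw [steps_shift, passageTime_translate, Nat.cast_add, add_comm (m : ℤ) n, ← zero_add (m : ℤ)]
  simpa using passageTime_mono (Set.subset_univ _) ⟨k, hk⟩

theorem passageTime_steps_congr {S : Set ℤ} {ω ω' : ℤ → ℕ → Bool} {i j : ℤ}
    (h : ∀ x ∈ S, ω x = ω' x) : passageTime S (steps ω) i j = passageTime S (steps ω') i j :=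
  passageTime_congr fun x hx => by funext k; simp [steps, h x hx]

theorem sum_range_mul_eq (f : ℕ → ℝ) (r n : ℕ) :
    ∑ i ∈ Finset.range (r * n), f i
      = ∑ c ∈ Finset.range r, ∑ t ∈ Finset.range n, f (c + r * t) := by
  induction n with
  | zero => simp
  | succ n ih =>
    rw [Nat.mul_succ, Finset.sum_range_add, ih, ← Finset.sum_add_distrib]
    refine Finset.sum_congr rfl fun c _ => ?_
    rw [Finset.sum_range_succ, add_comm (r * n) c]

/-- The time constant is at most the mean passage time over a block, divided by its length, even if
only frogs in a window around the block are used. -/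
theorem ae_limsup_le_window (p : unitInterval) (hp : 1 / 2 ≤ (p : ℝ)) (hp1 : (p : ℝ) < 1) {N K : ℕ}
    (hN : 0 < N) (hNK : N ≤ K) (hK : 3 ≤ K) :
    ∀ᵐ ω ∂modelLaw p, limsup (fun n : ℕ =>
        (passageTime Set.univ (steps ω) 0 n : ENNReal) / n) atTop
      ≤ (∫⁻ ω, (passageTime (Set.Icc (-(K : ℤ)) K) (steps ω) 0 N : ENNReal) ∂modelLaw p) / N := by
  set W : Set ℤ := Set.Icc (-(K : ℤ)) K with hW
  have hWN : Set.Icc (-3) (N : ℤ) ⊆ W := Set.Icc_subset_Icc (by omega) (by omega)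
  have hfin := lintegral_passageTime_ne_top p hp hp1 N hWN
  set I := ∫⁻ ω, (passageTime W (steps ω) 0 N : ENNReal) ∂modelLaw p with hI
  let Y : (ℤ → ℕ → Bool) → ℝ := fun ω => (passageTime W (steps ω) 0 N : ℝ)
  have hYm : Measurable Y :=
    (measurable_of_countable fun n : ℕ => (n : ℝ)).comp (measurable_passageTime W 0 N)
  have hYE : (fun ω => (passageTime W (steps ω) 0 N : ENNReal).toReal) = Y := by
    funext ω; simp [Y]
  have hYint : Integrable Y (modelLaw p) := by
    rw [← hYE]
    exact integrable_toReal_of_lintegral_ne_top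
      (measurable_passageTime_ennreal W 0 N).aemeasurable hfin
  have hYI : ∫ ω, Y ω ∂modelLaw p = I.toReal := by
    rw [← hYE, integral_toReal (measurable_passageTime_ennreal W 0 N).aemeasurable
      (Eventually.of_forall fun ω => ENNReal.natCast_lt_top _)]
  have hloc : ∀ ω ω', (∀ i ∈ Finset.Icc (-(K : ℤ)) K, ω i = ω' i) → Y ω = Y ω' := by
    intro ω ω' h
    simp only [Y]
    rw [passageTime_steps_congr fun x hx => h x (by simpa [hW] using hx)]
  -- blocks whose indices differ by a multiple of `r` use disjoint sets of frogs
  set r : ℕ := 2 * K + 1 with hr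
  have hlaw : ∀ c : ℕ, ∀ᵐ ω ∂modelLaw p, Tendsto (fun n : ℕ =>
      (∑ t ∈ Finset.range n, Y (shift (((c + r * t) * N : ℕ) : ℤ) ω)) / n) atTop
      (𝓝 I.toReal) := by
    intro c
    have hrN : (r : ℤ) ≤ ((r * N : ℕ) : ℤ) := by exact_mod_cast Nat.le_mul_of_pos_right r hN
    have h := ae_tendsto_sum_shift p hYm hYint hloc (d := ((r * N : ℕ) : ℤ)) (by omega) (by omega)
      ((c * N : ℕ) : ℤ)
    rw [hYI] at h
    filter_upwards [h] with ω hω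
    refine hω.congr fun n => ?_
    congr 1
    refine Finset.sum_congr rfl fun t _ => ?_
    congr 2
    push_cast
    ring
  filter_upwards [ae_connected p hp hp1, ae_all_iff.2 hlaw] with ω hω hωlaw
  let s : ℕ → ℝ := fun n => ∑ i ∈ Finset.range (r * n), Y (shift ((i * N : ℕ) : ℤ) ω)
  have hs : Tendsto (fun n : ℕ => s n / n) atTop (𝓝 (r * I.toReal)) := by
    have h1 : ∀ n : ℕ, s n / n = ∑ c ∈ Finset.range r,
        (∑ t ∈ Finset.range n, Y (shift (((c + r * t) * N : ℕ) : ℤ) ω)) / n := by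
      intro n
      rw [← Finset.sum_div]
      congr 1
      exact sum_range_mul_eq (fun i => Y (shift ((i * N : ℕ) : ℤ) ω)) r n
    simp only [h1]
    have h2 := tendsto_finsetSum (Finset.range r) fun c _ => hωlaw c
    simpa using h2
  have hT : ∀ n : ℕ, (passageTime Set.univ (steps ω) 0 (n * N : ℕ) : ℝ)
      ≤ ∑ i ∈ Finset.range n, Y (shift ((i * N : ℕ) : ℤ) ω) := by
    intro n
    induction n with
    | zero => simp [passageTime_self]
    | succ n ih =>
      rw [Finset.sum_range_succ, Nat.succ_mul]
      have h1 := hω.passageTime_add_le (n * N) N hWN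
      have h2 : (passageTime Set.univ (steps ω) 0 (n * N + N : ℕ) : ℝ)
        ≤ passageTime Set.univ (steps ω) 0 (n * N : ℕ)
          + passageTime W (steps (shift (n * N : ℕ) ω)) 0 N := by exact_mod_cast h1
      exact h2.trans (add_le_add ih le_rfl)
  -- a general `n` lies in the block that ends at `(r * N) * k n`
  set D : ℕ := r * N with hD
  have hD0 : 0 < D := Nat.mul_pos (by omega) hN
  let k : ℕ → ℕ := fun n => n / D + 1
  have hk : Tendsto k atTop atTop :=
    (tendsto_add_atTop_nat 1).comp (Nat.tendsto_div_const_atTop hD0.ne')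
  have hkn : Tendsto (fun n : ℕ => (k n : ℝ) / n) atTop (𝓝 (1 / D)) := by
    have h1 := (tendsto_nat_floor_mul_div_atTop (R := ℝ) (a := 1 / D) (by positivity)).comp
      tendsto_natCast_atTop_atTop
    have h2 := h1.add (tendsto_one_div_atTop_nhds_zero_nat (𝕜 := ℝ))
    rw [add_zero] at h2
    refine h2.congr fun n => ?_
    simp only [Function.comp_apply, k]
    rw [one_div_mul_eq_div, Nat.floor_div_natCast, Nat.floor_natCast, ← add_div]
    push_cast
    rfl
  have hlim : Tendsto (fun n : ℕ => s (k n) / k n * ((k n : ℝ) / n)) atTop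
      (𝓝 (r * I.toReal * (1 / D))) := (hs.comp hk).mul hkn
  have hlim2 := (ENNReal.continuous_ofReal.tendsto _).comp hlim
  have hle : ∀ᶠ n : ℕ in atTop, (passageTime Set.univ (steps ω) 0 n : ENNReal) / n
      ≤ ENNReal.ofReal (s (k n) / k n * ((k n : ℝ) / n)) := by
    filter_upwards [eventually_gt_atTop 0] with n hn
    have hn' : (0 : ℝ) < n := by exact_mod_cast hn
    have hk' : ((k n : ℕ) : ℝ) ≠ 0 := by positivity
    rw [div_mul_div_cancel₀ hk', ENNReal.ofReal_div_of_pos hn', ENNReal.ofReal_natCast]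
    refine ENNReal.div_le_div_right ?_ _
    have h1 : n ≤ r * k n * N := by
      have h2 := Nat.lt_div_mul_add (a := n) hD0
      have h3 : r * k n * N = n / D * D + D := by simp only [k, hD]; ring
      omega
    have h2 := hω.monotone h1
    have h3 : (passageTime Set.univ (steps ω) 0 n : ℝ) ≤ s (k n) :=
      (Nat.cast_le.2 h2).trans (hT (r * k n))
    rw [← ENNReal.ofReal_natCast]
    exact ENNReal.ofReal_le_ofReal h3
  refine (limsup_le_limsup hle).trans ((Tendsto.limsup_eq hlim2).le.trans (le_of_eq ?_))
  have hN' : (0 : ℝ) < N := by exact_mod_cast hN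
  have hrr : (r : ℝ) ≠ 0 := by positivity
  have h4 : (r : ℝ) * I.toReal * (1 / D) = I.toReal / N := by
    rw [hD]; push_cast; field_simp
  rw [h4, ENNReal.ofReal_div_of_pos hN', ENNReal.ofReal_toReal hfin, ENNReal.ofReal_natCast]

/-- Mean time that the front needs to arrive at `n`. -/
noncomputable def meanTime (p : unitInterval) (n : ℕ) : ENNReal :=
  ∫⁻ ω, (passageTime Set.univ (steps ω) 0 n : ENNReal) ∂modelLaw p

/-- The time constant: the asymptotic time per site that the front needs. -/
noncomputable def timeConstant (p : unitInterval) : ENNReal :=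
  ⨅ n : ℕ, meanTime p (n + 1) / (n + 1 : ℕ)

theorem meanTime_ne_top (p : unitInterval) (hp : 1 / 2 ≤ (p : ℝ)) (hp1 : (p : ℝ) < 1) (n : ℕ) :
    meanTime p n ≠ ⊤ := lintegral_passageTime_ne_top p hp hp1 n (Set.subset_univ _)

theorem tendsto_meanTime_window (p : unitInterval) (hp : 1 / 2 ≤ (p : ℝ)) (hp1 : (p : ℝ) < 1)
    (N : ℕ) : Tendsto (fun K : ℕ =>
      ∫⁻ ω, (passageTime (Set.Icc (-(K : ℤ)) K) (steps ω) 0 N : ENNReal) ∂modelLaw p)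
      atTop (𝓝 (meanTime p N)) := by
  have hsub : ∀ K : ℕ, N + 3 ≤ K → Set.Icc (-3) (N : ℤ) ⊆ Set.Icc (-(K : ℤ)) K := fun K hK =>
    Set.Icc_subset_Icc (by omega) (by omega)
  refine tendsto_lintegral_filter_of_dominated_convergence
    (fun ω => (passageTime (Set.Icc (-3) (N : ℤ)) (steps ω) 0 N : ENNReal))
    (Eventually.of_forall fun K => measurable_passageTime_ennreal _ 0 N) ?_
    (lintegral_passageTime_ne_top p hp hp1 N le_rfl) ?_
  · filter_upwards [eventually_ge_atTop (N + 3)] with K hK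
    filter_upwards [ae_connected p hp hp1] with ω hω
    exact_mod_cast passageTime_mono (hsub K hK)
      (hω.exists_reach (i := 0) (by omega) (by simp))
  · filter_upwards [ae_connected p hp hp1] with ω hω
    have hex := hω.exists_reach (S := Set.univ) (i := 0) (j := N) (by omega) (Set.subset_univ _)
    -- an optimal chain consists of finitely many frogs
    obtain ⟨l, -, hl⟩ := (reach_passageTime hex).exists_chain
    obtain ⟨K₀, hK₀⟩ : ∃ K₀ : ℕ, ∀ x ∈ l, x.natAbs ≤ K₀ :=
      ⟨(l.map Int.natAbs).sum, fun x hx => List.single_le_sum (by simp) _ (List.mem_map_of_mem hx)⟩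
    refine tendsto_const_nhds.congr' ?_
    filter_upwards [eventually_ge_atTop K₀] with K hK
    have hr : Reach (Set.Icc (-(K : ℤ)) K) (steps ω) 0 N
        (passageTime Set.univ (steps ω) 0 N) := hl.mono fun x hx => by
      have := hK₀ x hx
      exact Set.mem_Icc.2 ⟨by omega, by omega⟩
    have := le_antisymm (passageTime_mono (Set.subset_univ _) ⟨_, hr⟩) (passageTime_le hr)
    rw [this]

theorem ae_limsup_le_timeConstant (p : unitInterval) (hp : 1 / 2 ≤ (p : ℝ)) (hp1 : (p : ℝ) < 1) :
    ∀ᵐ ω ∂modelLaw p, limsup (fun n : ℕ =>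
      (passageTime Set.univ (steps ω) 0 n : ENNReal) / n) atTop ≤ timeConstant p := by
  have h : ∀ N K : ℕ, ∀ᵐ ω ∂modelLaw p, N + 1 ≤ K → 3 ≤ K → limsup (fun n : ℕ =>
        (passageTime Set.univ (steps ω) 0 n : ENNReal) / n) atTop
      ≤ (∫⁻ ω, (passageTime (Set.Icc (-(K : ℤ)) K) (steps ω) 0 (N + 1 : ℕ) : ENNReal) ∂modelLaw p)
        / (N + 1 : ℕ) := by
    intro N K
    by_cases h1 : N + 1 ≤ K
    · by_cases h2 : 3 ≤ K
      · filter_upwards [ae_limsup_le_window p hp hp1 (Nat.succ_pos N) h1 h2] with ω hω _ _ using hω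
      · exact Eventually.of_forall fun ω _ h => absurd h h2
    · exact Eventually.of_forall fun ω h => absurd h h1
  filter_upwards [ae_all_iff.2 fun N => ae_all_iff.2 (h N)] with ω hω
  refine le_iInf fun N => ?_
  refine ge_of_tendsto (ENNReal.Tendsto.div_const (tendsto_meanTime_window p hp hp1 (N + 1))
    (Or.inr (by simp))) ?_
  filter_upwards [eventually_ge_atTop (N + 1), eventually_ge_atTop 3] with K h1 h2
  exact hω N K h1 h2

/-! ### The lower bound for the passage times -/

/-- Lower asymptotic time per site. -/
noncomputable def lowerTime (ω : ℤ → ℕ → Bool) : ENNReal :=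
  liminf (fun n : ℕ => (passageTime Set.univ (steps ω) 0 n : ENNReal) / n) atTop

theorem measurable_lowerTime : Measurable lowerTime :=
  Measurable.liminf fun n => (measurable_passageTime_ennreal _ 0 n).div_const _

theorem Connected.lowerTime_le {ω : ℤ → ℕ → Bool} (h : Connected ω) :
    lowerTime ω ≤ lowerTime (shift 1 ω) := by
  refine le_of_forall_gt fun c hc => ?_
  obtain ⟨b, hb, hbc⟩ := exists_between hc
  obtain ⟨a, hba, hac⟩ := exists_between hbc
  refine lt_of_le_of_lt ?_ hac
  have h1 := frequently_lt_of_liminf_lt (by isBoundedDefault) hb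
  have h2 : Tendsto (fun n : ℕ => (passageTime Set.univ (steps ω) 0 (1 : ℕ) : ENNReal) / n) atTop
      (𝓝 0) := by
    have := ENNReal.Tendsto.const_div ENNReal.tendsto_nat_nhds_top
      (a := (passageTime Set.univ (steps ω) 0 (1 : ℕ) : ENNReal)) (Or.inr (by simp))
    simpa using this
  have h3 := h2.eventually_lt_const (tsub_pos_of_lt hba)
  rw [lowerTime, ← liminf_nat_add _ 1]
  refine liminf_le_of_frequently_le' ((h1.and_eventually h3).mono fun n ⟨h4, h5⟩ => ?_)
  have h6 := h.passageTime_add_le (S := Set.univ) 1 n (Set.subset_univ _)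
  have h7 : (passageTime Set.univ (steps ω) 0 (n + 1 : ℕ) : ENNReal)
      ≤ passageTime Set.univ (steps ω) 0 (1 : ℕ)
        + passageTime Set.univ (steps (shift 1 ω)) 0 n := by
    rw [add_comm n 1]
    exact_mod_cast h6
  calc (passageTime Set.univ (steps ω) 0 (n + 1 : ℕ) : ENNReal) / (n + 1 : ℕ)
      ≤ (passageTime Set.univ (steps ω) 0 (1 : ℕ)
        + passageTime Set.univ (steps (shift 1 ω)) 0 n) / n := by
        gcongr
        exact Nat.le_succ n
    _ = passageTime Set.univ (steps ω) 0 (1 : ℕ) / n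
        + passageTime Set.univ (steps (shift 1 ω)) 0 n / n := ENNReal.add_div
    _ ≤ (a - b) + b := add_le_add h5.le h4.le
    _ = a := tsub_add_cancel_of_le hba.le

theorem ae_lowerTime_le (p : unitInterval) (hp : 1 / 2 ≤ (p : ℝ)) (hp1 : (p : ℝ) < 1) :
    ∀ᵐ ω ∂modelLaw p, lowerTime ω ≤ timeConstant p := by
  filter_upwards [ae_limsup_le_timeConstant p hp hp1] with ω hω
  exact (liminf_le_limsup).trans hω

theorem timeConstant_ne_top (p : unitInterval) (hp : 1 / 2 ≤ (p : ℝ)) (hp1 : (p : ℝ) < 1) :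
    timeConstant p ≠ ⊤ :=
  ne_top_of_le_ne_top (ENNReal.div_ne_top (meanTime_ne_top p hp hp1 1) (by simp))
    (iInf_le _ 0)

theorem lintegral_lowerTime_ne_top (p : unitInterval) (hp : 1 / 2 ≤ (p : ℝ)) (hp1 : (p : ℝ) < 1) :
    ∫⁻ ω, lowerTime ω ∂modelLaw p ≠ ⊤ := by
  refine ne_top_of_le_ne_top (timeConstant_ne_top p hp hp1)
    ((lintegral_mono_ae (ae_lowerTime_le p hp hp1)).trans ?_)
  simp

/-- The lower asymptotic time per site is invariant: it can only grow under the shift, but its mean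
does not change. -/
theorem ae_lowerTime_shift (p : unitInterval) (hp : 1 / 2 ≤ (p : ℝ)) (hp1 : (p : ℝ) < 1) :
    ∀ᵐ ω ∂modelLaw p, lowerTime (shift 1 ω) = lowerTime ω := by
  have h1 : ∀ᵐ ω ∂modelLaw p, lowerTime ω ≤ lowerTime (shift 1 ω) := by
    filter_upwards [ae_connected p hp hp1] with ω hω using hω.lowerTime_le
  have h2 := ae_eq_of_ae_le_of_lintegral_le (f := lowerTime) (g := fun ω => lowerTime (shift 1 ω))
    h1 (lintegral_lowerTime_ne_top p hp hp1)
    (measurable_lowerTime.comp (measurable_shift 1)).aemeasurable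
    ((measurePreserving_shift p 1).lintegral_comp measurable_lowerTime).le
  filter_upwards [h2] with ω hω using hω.symm

/-- Configurations for which the lower asymptotic time per site is the same from all sites on the
right half-line. -/
def Regular (ω : ℤ → ℕ → Bool) : Prop :=
  Connected ω ∧ ∀ k : ℕ, lowerTime (shift k ω) = lowerTime ω

theorem Regular.comp_shift {ω : ℤ → ℕ → Bool} (h : Regular ω) (k : ℕ) : Regular (shift k ω) := by
  refine ⟨h.1.comp_shift k, fun j => ?_⟩
  rw [shift_shift, h.2 k, ← Nat.cast_add, h.2]

theorem ae_regular (p : unitInterval) (hp : 1 / 2 ≤ (p : ℝ)) (hp1 : (p : ℝ) < 1) :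
    ∀ᵐ ω ∂modelLaw p, Regular ω := by
  have h1 : ∀ᵐ ω ∂modelLaw p, ∀ k : ℕ, lowerTime (shift k ω) = lowerTime ω := by
    refine ae_all_iff.2 fun k => ?_
    induction k with
    | zero => exact Eventually.of_forall fun ω => by simp [shift_zero]
    | succ k ih =>
      filter_upwards [ih, (measurePreserving_shift p k).quasiMeasurePreserving.ae
        (ae_lowerTime_shift p hp hp1)] with ω h2 h3
      rw [shift_shift] at h3
      rw [← h2, ← h3]
      congr 2
      push_cast
      ring
  filter_upwards [ae_connected p hp hp1, h1] with ω h2 h3 using ⟨h2, h3⟩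

/-- Within distance `M` there is no site that the front reaches with a time per site close to the
lower asymptotic one. -/
def Late (ε : ENNReal) (M : ℕ) : Set (ℤ → ℕ → Bool) :=
  {ω | ∀ n, 1 ≤ n → n ≤ M →
    (lowerTime ω + ε) * n < (passageTime Set.univ (steps ω) 0 n : ENNReal)}

theorem measurableSet_late (ε : ENNReal) (M : ℕ) : MeasurableSet (Late ε M) := by
  have : Late ε M = ⋂ n ∈ Set.Icc 1 M,
      {ω | (lowerTime ω + ε) * n < (passageTime Set.univ (steps ω) 0 n : ENNReal)} := by
    ext; simp [Late]
  rw [this]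
  exact MeasurableSet.biInter (Set.to_countable _) fun n _ =>
    measurableSet_lt ((measurable_lowerTime.add_const ε).mul_const _)
      (measurable_passageTime_ennreal _ 0 n)

/-- Cost of a step to the next site in a late configuration. -/
noncomputable def lateCost (ε : ENNReal) (M : ℕ) : (ℤ → ℕ → Bool) → ENNReal :=
  (Late ε M).indicator fun ω => (passageTime Set.univ (steps ω) 0 (1 : ℕ) : ENNReal)

theorem measurable_lateCost (ε : ENNReal) (M : ℕ) : Measurable (lateCost ε M) :=
  (measurable_passageTime_ennreal _ 0 _).indicator (measurableSet_late ε M)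

/-- The covering argument of Katznelson and Weiss: the way to `n` is cut into pieces, each of
which is either a favourable stretch of length at most `M` or a single step from a late site. -/
theorem Regular.passageTime_le {ε : ENNReal} {M : ℕ} (n : ℕ) :
    ∀ {ω : ℤ → ℕ → Bool}, Regular ω → (passageTime Set.univ (steps ω) 0 n : ENNReal)
      ≤ (lowerTime ω + ε) * (n + M : ℕ)
        + ∑ k ∈ Finset.range (n + M), lateCost ε M (shift k ω) := by
  induction n using Nat.strong_induction_on with
  | _ n ih =>
    intro ω hω
    rcases Nat.eq_zero_or_pos n with rfl | hn
    · simp [passageTime_self]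
    have split : ∀ j, 1 ≤ j → j ≤ n → (passageTime Set.univ (steps ω) 0 n : ENNReal)
        ≤ passageTime Set.univ (steps ω) 0 j + ((lowerTime ω + ε) * (n - j + M : ℕ)
          + ∑ k ∈ Finset.range (n - j + M), lateCost ε M (shift (j + k : ℕ) ω)) := by
      intro j hj hjn
      have h1 := hω.1.passageTime_add_le (S := Set.univ) j (n - j) (Set.subset_univ _)
      rw [Nat.add_sub_cancel' hjn] at h1
      have h2 := ih (n - j) (by omega) (hω.comp_shift j)
      rw [hω.2 j] at h2
      have h3 : ∀ k : ℕ, shift k (shift j ω) = shift (j + k : ℕ) ω := fun k => by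
        rw [shift_shift, add_comm]; push_cast; rfl
      simp only [h3] at h2
      refine le_trans ?_ (add_le_add_right h2 _)
      exact_mod_cast h1
    by_cases hlate : ω ∈ Late ε M
    · have h1 := split 1 le_rfl hn
      have h2 : n + M = (n - 1 + M) + 1 := by omega
      rw [h2, Finset.sum_range_succ']
      have h3 : lateCost ε M (shift (0 : ℕ) ω) = passageTime Set.univ (steps ω) 0 (1 : ℕ) := by
        have : shift (0 : ℕ) ω = ω := shift_zero ω
        rw [this, lateCost, Set.indicator_of_mem hlate]
      rw [h3]
      refine h1.trans ?_
      rw [add_comm, add_assoc]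
      refine add_le_add (mul_le_mul_right (by exact_mod_cast Nat.le_succ _) _) ?_
      refine add_le_add (le_of_eq ?_) le_rfl
      refine Finset.sum_congr rfl fun k _ => ?_
      rw [add_comm 1 k]
    · simp only [Late, Set.mem_ofPred_eq, not_forall, not_lt] at hlate
      obtain ⟨j, hj1, hjM, hj⟩ := hlate
      rcases le_or_gt j n with hjn | hjn
      · refine (split j hj1 hjn).trans ?_
        rw [← add_assoc]
        refine add_le_add ?_ ?_
        · refine (add_le_add hj le_rfl).trans (le_of_eq ?_)
          rw [← mul_add, ← Nat.cast_add]
          congr 2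
          omega
        · have h2 : n + M = j + (n - j + M) := by omega
          rw [h2]
          exact le_add_self.trans
            (Finset.sum_range_add (fun k : ℕ => lateCost ε M (shift k ω)) j (n - j + M)).ge
      · have h1 : (passageTime Set.univ (steps ω) 0 n : ENNReal)
            ≤ passageTime Set.univ (steps ω) 0 j := by exact_mod_cast hω.1.monotone hjn.le
        refine (h1.trans hj).trans (le_add_right ?_)
        exact mul_le_mul_right (by exact_mod_cast (by omega : j ≤ n + M)) _

theorem timeConstant_mul_le (p : unitInterval) (n : ℕ) : timeConstant p * n ≤ meanTime p n := by
  cases n with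
  | zero => simp
  | succ n =>
    have h := iInf_le (fun n : ℕ => meanTime p (n + 1) / (n + 1 : ℕ)) n
    rwa [ENNReal.le_div_iff_mul_le (by simp) (by simp)] at h

theorem le_of_forall_mul_le {a b : ENNReal} (M : ℕ) (h : ∀ n : ℕ, a * n ≤ b * (n + M : ℕ)) :
    a ≤ b := by
  have h1 : Tendsto (fun n : ℕ => b + b * M / n) atTop (𝓝 (b + b * M / ⊤)) := by
    rcases eq_or_ne b ⊤ with rfl | hb
    · simp
    · exact tendsto_const_nhds.add (ENNReal.Tendsto.const_div ENNReal.tendsto_nat_nhds_top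
        (Or.inr (ENNReal.mul_ne_top hb (by simp))))
  rcases eq_or_ne b ⊤ with rfl | hb
  · exact le_top
  rw [ENNReal.div_top, add_zero] at h1
  refine ge_of_tendsto h1 ((eventually_gt_atTop 0).mono fun n hn => ?_)
  have hn' : (n : ENNReal) ≠ 0 := by exact_mod_cast hn.ne'
  have h2 := h n
  rw [← ENNReal.le_div_iff_mul_le (Or.inl hn') (by simp)] at h2
  refine h2.trans (le_of_eq ?_)
  rw [Nat.cast_add, mul_add, ENNReal.add_div, ENNReal.mul_div_cancel_right hn' (by simp)]

theorem timeConstant_le_lintegral (p : unitInterval) (hp : 1 / 2 ≤ (p : ℝ)) (hp1 : (p : ℝ) < 1) :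
    timeConstant p ≤ ∫⁻ ω, lowerTime ω ∂modelLaw p := by
  refine ENNReal.le_of_forall_pos_le_add fun ε hε _ => ?_
  have hε' : (ε : ENNReal) ≠ 0 := by exact_mod_cast hε.ne'
  have hM : ∀ M : ℕ, timeConstant p ≤ (∫⁻ ω, lowerTime ω ∂modelLaw p) + ε
      + ∫⁻ ω, lateCost ε M ω ∂modelLaw p := by
    intro M
    have hmeas : ∀ k : ℕ, Measurable fun ω => lateCost ε M (shift k ω) := fun k =>
      (measurable_lateCost _ M).comp (measurable_shift k)
    refine le_of_forall_mul_le M fun n => (timeConstant_mul_le p n).trans ?_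
    have h1 : meanTime p n ≤ ∫⁻ ω, ((lowerTime ω + ε) * (n + M : ℕ)
        + ∑ k ∈ Finset.range (n + M), lateCost ε M (shift k ω)) ∂modelLaw p := by
      refine lintegral_mono_ae ?_
      filter_upwards [ae_regular p hp hp1] with ω hω using hω.passageTime_le n
    refine h1.trans (le_of_eq ?_)
    rw [lintegral_add_left ((measurable_lowerTime.add_const _).mul_const _),
      lintegral_mul_const _ (measurable_lowerTime.add_const _),
      lintegral_add_right _ measurable_const, lintegral_const, measure_univ, mul_one,
      lintegral_finsetSum _ fun k _ => hmeas k]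
    have h2 : ∀ k : ℕ, ∫⁻ ω, lateCost ε M (shift k ω) ∂modelLaw p
        = ∫⁻ ω, lateCost ε M ω ∂modelLaw p := fun k =>
      (measurePreserving_shift p k).lintegral_comp (measurable_lateCost _ M)
    simp only [h2, Finset.sum_const, Finset.card_range, nsmul_eq_mul]
    ring
  have hlim : Tendsto (fun M => ∫⁻ ω, lateCost ε M ω ∂modelLaw p) atTop
      (𝓝 (∫⁻ _, 0 ∂modelLaw p)) := by
    refine tendsto_lintegral_of_dominated_convergence
      (fun ω => (passageTime Set.univ (steps ω) 0 (1 : ℕ) : ENNReal))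
      (fun M => measurable_lateCost _ M)
      (fun M => Eventually.of_forall fun ω => Set.indicator_le_self _ _ ω)
      (meanTime_ne_top p hp hp1 1) ?_
    filter_upwards [ae_lowerTime_le p hp hp1] with ω hω
    have hfin : lowerTime ω ≠ ⊤ := ne_top_of_le_ne_top (timeConstant_ne_top p hp hp1) hω
    have hlt : lowerTime ω < lowerTime ω + ε := ENNReal.lt_add_right hfin hε'
    obtain ⟨n, hn, hn0⟩ := ((frequently_lt_of_liminf_lt (by isBoundedDefault) hlt).and_eventually
      (eventually_gt_atTop 0)).exists
    refine tendsto_const_nhds.congr' ((eventually_ge_atTop n).mono fun M hnM => ?_)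
    have : ω ∉ Late ε M := fun h => by
      have h1 := h n hn0 hnM
      have hn' : (n : ENNReal) ≠ 0 := by exact_mod_cast hn0.ne'
      rw [ENNReal.div_lt_iff (Or.inl hn') (by simp)] at hn
      exact lt_asymm h1 hn
    exact (Set.indicator_of_notMem this _).symm
  rw [lintegral_zero] at hlim
  have h3 := tendsto_const_nhds (x := (∫⁻ ω, lowerTime ω ∂modelLaw p) + ε) |>.add hlim
  rw [add_zero] at h3
  exact ge_of_tendsto' h3 hM

/-- Almost surely, the front needs asymptotically the time `timeConstant p` per site. -/
theorem ae_tendsto_passageTime (p : unitInterval) (hp : 1 / 2 ≤ (p : ℝ)) (hp1 : (p : ℝ) < 1) :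
    ∀ᵐ ω ∂modelLaw p, Tendsto (fun n : ℕ => (passageTime Set.univ (steps ω) 0 n : ℝ) / n) atTop
      (𝓝 (timeConstant p).toReal) := by
  have h1 := ae_eq_of_ae_le_of_lintegral_le (ae_lowerTime_le p hp hp1)
    (lintegral_lowerTime_ne_top p hp hp1) aemeasurable_const (by
      simpa using timeConstant_le_lintegral p hp hp1)
  filter_upwards [h1, ae_limsup_le_timeConstant p hp hp1] with ω h2 h3
  have h4 := tendsto_of_le_liminf_of_limsup_le (u := fun n : ℕ =>
    (passageTime Set.univ (steps ω) 0 n : ENNReal) / n) h2.ge h3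
  have h5 := (ENNReal.tendsto_toReal (timeConstant_ne_top p hp hp1)).comp h4
  refine h5.congr fun n => ?_
  simp

/-! ### The bound on the time constant -/

theorem le_timeConstant (p : unitInterval) (hp : 1 / 2 ≤ (p : ℝ)) (hp1 : (p : ℝ) < 1) {q : ℝ}
    (hq : q = 1 - p) {m : ℕ} (hm : 1 / (2 * q ^ 2) + 4 / q + 14 ≤ m) :
    1 + q ^ (1 / q) / (m + 1) ≤ (timeConstant p).toReal := by
  classical
  have hq0 : 0 < q := by linarith
  have hq1 : q ≤ 1 / 2 := by linarith
  set φ := q ^ (1 / q) / 2 with hφ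
  have hφ0 : 0 < φ := by positivity
  have hmeasA : ∀ k : ℕ, MeasurableSet {ω | NoFastFrog m (steps ω) (k : ℕ)} := fun k => by
    have : {ω | NoFastFrog m (steps ω) (k : ℕ)}
        = ⋂ l : ℕ, {ω : ℤ → ℕ → Bool | ω (k - l) ∈ (Fast m l)ᶜ} := by
      ext ω; simp [noFastFrog_steps_iff]
    rw [this]
    exact MeasurableSet.iInter fun l =>
      (measurable_pi_apply ((k : ℤ) - (l : ℤ))) (measurableSet_fast m l).compl
  have hmean : ∀ n : ℕ, ENNReal.ofReal ((m + 1) * n + 2 * (n * φ)) ≤ (m + 1 : ℕ) * meanTime p n := by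
    intro n
    have h1 : ∀ᵐ ω ∂modelLaw p, (((m + 1) * n : ℕ) : ENNReal) + 2 * ∑ k ∈ Finset.range n,
        {ω | NoFastFrog m (steps ω) (k : ℕ)}.indicator 1 ω
          ≤ (m + 1 : ℕ) * (passageTime Set.univ (steps ω) 0 n : ENNReal) := by
      filter_upwards [ae_connected p hp hp1] with ω hω
      have h2 := card_noFastFrog_le (steps_eq ω) m
        (fun j => hω.exists_reach (S := Set.univ) (i := 0) (by omega) (Set.subset_univ _)) n
      have h3 : ∑ k ∈ Finset.range n, {ω | NoFastFrog m (steps ω) (k : ℕ)}.indicator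
          (1 : (ℤ → ℕ → Bool) → ENNReal) ω
          = (((Finset.range n).filter (fun k => NoFastFrog m (steps ω) (k : ℕ))).card : ENNReal) := by
        rw [Finset.card_filter]
        push_cast
        refine Finset.sum_congr rfl fun k _ => ?_
        simp [Set.indicator]
      rw [h3]
      exact_mod_cast h2
    have h4 := lintegral_mono_ae h1
    rw [lintegral_const_mul _ (measurable_passageTime_ennreal _ 0 n),
      lintegral_add_left measurable_const, lintegral_const, measure_univ, mul_one,
      lintegral_const_mul _ (Finset.measurable_sum _ fun k _ =>
        measurable_one.indicator (hmeasA k)),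
      lintegral_finsetSum _ fun k _ => measurable_one.indicator (hmeasA k)] at h4
    refine le_trans ?_ h4
    rw [ENNReal.ofReal_add (by positivity) (by positivity), ENNReal.ofReal_mul (p := 2) (by norm_num)]
    refine add_le_add (le_of_eq ?_) (mul_le_mul' (by simp) ?_)
    · rw [← ENNReal.ofReal_natCast]; push_cast; rfl
    · have h5 : ∀ k ∈ Finset.range n, ENNReal.ofReal φ ≤ ∫⁻ ω,
          {ω | NoFastFrog m (steps ω) (k : ℕ)}.indicator 1 ω ∂modelLaw p := fun k _ => by
        rw [lintegral_indicator_one (hmeasA k)]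
        exact measure_noFastFrog_ge p hq hq0 hq1 hm k
      refine le_trans (le_of_eq ?_) (Finset.sum_le_sum h5)
      rw [Finset.sum_const, Finset.card_range, nsmul_eq_mul,
        ENNReal.ofReal_mul (Nat.cast_nonneg n), ENNReal.ofReal_natCast]
  have hm0 : (0 : ℝ) < (m : ℝ) + 1 := by positivity
  have hle : ENNReal.ofReal (1 + 2 * φ / (m + 1)) ≤ timeConstant p := by
    refine le_iInf fun n => ?_
    rw [ENNReal.le_div_iff_mul_le (by simp) (by simp)]
    have h1 := hmean (n + 1)
    have h2 : ((m : ℝ) + 1) * (n + 1 : ℕ) + 2 * ((n + 1 : ℕ) * φ)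
        = ((m + 1 : ℕ) : ℝ) * ((1 + 2 * φ / (m + 1)) * (n + 1 : ℕ)) := by
      push_cast; field_simp
    rw [h2, ENNReal.ofReal_mul (Nat.cast_nonneg _), ENNReal.ofReal_natCast] at h1
    have h3 := (ENNReal.mul_le_mul_iff_right (a := ((m + 1 : ℕ) : ENNReal)) (by simp) (by simp)).1 h1
    rwa [ENNReal.ofReal_mul (by positivity), ENNReal.ofReal_natCast] at h3
  have h6 := (ENNReal.ofReal_le_iff_le_toReal (timeConstant_ne_top p hp hp1)).1 hle
  have h7 : 2 * φ / ((m : ℝ) + 1) = q ^ (1 / q) / (m + 1) := by rw [hφ]; ring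
  rwa [h7] at h6

end FrogModel

theorem theorem3 (p : ℝ) (hp : 1 / 2 ≤ p) (hp1 : p < 1) :
    ∃ v : ℝ, 0 < v ∧
      (∀ (Ω : Type*) [MeasurableSpace Ω] (P : Measure Ω) [IsProbabilityMeasure P]
        (X : ℤ → ℕ → Ω → ℤ), FrogModel.IsStepArray p P X →
          ∀ᵐ ω ∂P, Tendsto
            (fun n : ℕ => (FrogModel.maximum (fun i k => X i k ω) n : ℝ) / (n : ℝ))
            atTop (𝓝 v)) ∧
      v < 1 ∧
      (1 / 2 < p →
        1 + 2 * (1 - p) ^ ((2 - p) * p / ((1 - p) * (2 * p - 1))) ≤ 1 / v) := by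
  open FrogModel in
  obtain ⟨r, rfl⟩ : ∃ r : unitInterval, (r : ℝ) = p := ⟨⟨p, by linarith, hp1.le⟩, rfl⟩
  have hq0 : 0 < 1 - (r : ℝ) := by linarith
  obtain ⟨m, hm1, hm2⟩ : ∃ m : ℕ, 1 / (2 * (1 - (r : ℝ)) ^ 2) + 4 / (1 - (r : ℝ)) + 14 ≤ m ∧
      (m : ℝ) ≤ 1 / (2 * (1 - (r : ℝ)) ^ 2) + 4 / (1 - (r : ℝ)) + 15 := by
    refine ⟨⌈1 / (2 * (1 - (r : ℝ)) ^ 2) + 4 / (1 - (r : ℝ)) + 14⌉₊, Nat.le_ceil _, ?_⟩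
    have := Nat.ceil_lt_add_one
      (show 0 ≤ 1 / (2 * (1 - (r : ℝ)) ^ 2) + 4 / (1 - (r : ℝ)) + 14 by positivity)
    linarith
  have hbound := le_timeConstant r hp hp1 rfl hm1
  set γ := (timeConstant r).toReal
  have hφ : 0 < (1 - (r : ℝ)) ^ (1 / (1 - (r : ℝ))) / (m + 1) := by positivity
  have hγ1 : 1 < γ := by linarith
  have hγ0 : 0 < γ := by linarith
  refine ⟨1 / γ, by positivity, ?_, (div_lt_one hγ0).2 hγ1, fun hp2 => ?_⟩
  · intro Ω _ P _ X hX
    have hae : ∀ᵐ ω ∂modelLaw r, Tendsto (fun n : ℕ => (maximum (steps ω) n : ℝ) / n) atTop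
        (𝓝 (1 / γ)) := by
      filter_upwards [ae_connected r hp hp1, ae_tendsto_passageTime r hp hp1] with ω h1 h2
      exact tendsto_maximum (steps_eq ω) (fun j =>
        h1.exists_reach (i := 0) (by omega) (Set.subset_univ _)) hγ0 h2
    rw [← map_eq_modelLaw hX] at hae
    have hm : Measurable fun ω (i : ℤ) (k : ℕ) => decide (X i k ω = 1) :=
      measurable_pi_iff.2 fun i => measurable_pi_iff.2 fun k =>
        (measurable_of_countable fun z : ℤ => decide (z = 1)).comp (hX.measurable i k)
    filter_upwards [ae_of_ae_map hm.aemeasurable hae, ae_steps_eq hX] with ω h1 h2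
    rwa [h2] at h1
  · rw [one_div_one_div]
    refine le_trans ?_ hbound
    have h := two_mul_succ_mul_rpow_le hq0 (by linarith) hm2
    have he : (1 + (1 - (r : ℝ))) * (1 - (1 - (r : ℝ))) / ((1 - (r : ℝ)) * (1 - 2 * (1 - (r : ℝ))))
        = (2 - r) * r / ((1 - r) * (2 * r - 1)) := by
      congr 1 <;> ring
    rw [he] at h
    have hm0 : (0 : ℝ) < (m : ℝ) + 1 := by positivity
    have h3 : 2 * (1 - (r : ℝ)) ^ ((2 - (r : ℝ)) * r / ((1 - r) * (2 * r - 1)))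
        ≤ (1 - (r : ℝ)) ^ (1 / (1 - (r : ℝ))) / (m + 1) := by
      rw [le_div_iff₀ hm0]
      linarith
    linarith
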